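/- Let $R>0$, let $N=4$, and let $\Gamma_1,\dots,\Gamma_4\in\mathbb{R}$ be the (nonzero) circulations of four point vortices $\mathbf{x}_1,\dots,\mathbf{x}_4$ on the sphere $\mathbb{S}^2_R\subset\mathbb{R}^3$ of radius $R$ about the origin. **Shape variables.** The phase space of the shape dynamics is $$\mathcal{S}_4=(0,2)^3\times(\mathbb{C}\setminus\{0\})^3=\{\zeta=(|\lambda_{14}|,|\lambda_{24}|,|\lambda_{34}|,\mu_{12},\mu_{13},\mu_{23})\}.$$ With $\ell_{ij}=|\mathbf{x}_i-\mathbf{x}_j|$ and $|\lambda_{ij}|^2=4-\ell_{ij}^2/R^2$, the shape variables of a configuration $(\mathbf{x}_1,\dots,\mathbf{x}_4)$ are $|\lambda_{i4}|=\sqrt{4-\ell_{i4}^2/R^2}$ and, for $1\le i<j\le 3$, $$\operatorname{Re}\mu_{ij}=|\lambda_{ij}|^2+|\lambda_{i4}|^2+|\lambda_{j4}|^2-4,\qquad \operatorname{Im}\mu_{ij}=\frac{2}{R^3}\,\mathbf{x}_i\cdot(\mathbf{x}_j\times\mathbf{x}_4).$$ **Poisson bracket.** Let $D_\Gamma=\operatorname{diag}(\Gamma_1,\dots,\Gamma_4)$,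 and let $\mathfrak{u}(4)_\Gamma$ be the space of skew-Hermitian $4\times4$ matrices with the Lie bracket $[\xi,\eta]_\Gamma=\xi D_\Gamma^{-1}\eta-\eta D_\Gamma^{-1}\xi$, identified with its dual by $\langle\xi,\eta\rangle=2\operatorname{tr}(\xi^*\eta)$. The dual carries the Lie--Poisson bracket $\{f,h\}(\lambda)=-\langle\lambda,[\delta f/\delta\lambda,\delta h/\delta\lambda]_\Gamma\rangle$. Write the entries of $\lambda$ as $-\tfrac{\mathrm{i}}{2}\lambda_{ij}$ for $i<j$ and $-\tfrac{\mathrm{i}}{2}\sqrt2\,\lambda_i$ on the diagonal. The functions $|\lambda_{i4}|$ and $\mu_{ij}=\lambda_{ij}\bar\lambda_{i4}\lambda_{j4}$ are invariant under conjugation of $\lambda$ by $\operatorname{diag}(e^{\mathrm{i}\theta_1},e^{\mathrm{i}\theta_2},e^{\mathrm{i}\theta_3},1)$. The bracket on $\mathcal{S}_4$ is the reduced one: $\{F,G\}(\zeta)$ is the Lie--Poisson bracket of $F$ and $G$, regarded as functions of $\lambda$ through these invariants, at a point $\lambda$ with $\lambda_1=\dots=\lambda_4=\sqrt2$ lying over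 $\zeta$. **Shape dynamics.** This is the Hamiltonian system $\dot\zeta=\{\zeta,\mathcal{H}\}$ on $\mathcal{S}_4$ with $$\mathcal{H}(\zeta)=-\frac{1}{4\pi R^2}\Bigl(\sum_{1\le i<j\le3}\Gamma_i\Gamma_j\ln\Bigl(R^2\Bigl(4-\frac{|\mu_{ij}|^2}{|\lambda_{i4}|^2|\lambda_{j4}|^2}\Bigr)\Bigr)+\Gamma_4\sum_{i=1}^3\Gamma_i\ln\bigl(R^2(4-|\lambda_{i4}|^2)\bigr)\Bigr).$$ **Proposition.** Suppose that all four circulations have the same sign (all positive or all negative). Let $\mathbf{x}_1,\dots,\mathbf{x}_4\in\mathbb{S}^2_R$ form a regular tetrahedron, i.e. $\ell_{ij}=2\sqrt{2/3}\,R$ for all $i\ne j$. Then its shape $\zeta_{\mathrm e}\in\mathcal{S}_4$ is a (Lyapunov) stable equilibrium of the shape dynamics: $\zeta_{\mathrm e}$ is a zero of the vector field, and for every $\varepsilon>0$ there is $\delta>0$ such that for every initial point $\zeta_0\in\mathcal{S}_4$ within $\delta$ of $\zeta_{\mathrm e}$ there is a solution starting at $\zeta_0$ defined for all $t\ge0$,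 and every solution starting at $\zeta_0$, on any interval $[0,T)$, stays within $\varepsilon$ of $\zeta_{\mathrm e}$. -/

import Mathlib

open scoped Matrix

noncomputable section

namespace VortexShape

/-!  Throughout there are `n + 1` vortices, indexed by `Fin (n + 1)`; the vortex called `N` in the
usual notation is `Fin.last n`, and `i : Fin n` stands for the vortex `Fin.castSucc i`. -/

/-- The pairs `i < j` of vortices different from the last one. -/
abbrev Pairs (n : ℕ) : Type := {p : Fin n × Fin n // p.1 < p.2}

/-- The ambient real vector space of the shape variables
`ζ = (|λ_{1N}|, …, |λ_{N-1,N}|, μ_{12}, …, μ_{N-2,N-1})`. -/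
abbrev ShapeVar (n : ℕ) : Type := (Fin n → ℝ) × (Pairs n → ℂ)

/-- The phase space `(0,2)^{N-1} × (ℂ ∖ {0})^{(N-1)(N-2)/2}` of the shape dynamics. -/
def shapeSpace (n : ℕ) : Set (ShapeVar n) :=
  {ζ | (∀ i, ζ.1 i ∈ Set.Ioo (0 : ℝ) 2) ∧ ∀ p, ζ.2 p ≠ 0}

/-! ### The Lie algebra `u(N)_Γ` and its Lie–Poisson bracket -/

/-- The Lie bracket `[ξ, η]_Γ = ξ D_Γ⁻¹ η - η D_Γ⁻¹ ξ`, where `D_Γ = diag (Γ_1, …, Γ_N)`. -/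
def lieBracket {n : ℕ} (Γ : Fin (n + 1) → ℝ) (ξ η : Matrix (Fin (n + 1)) (Fin (n + 1)) ℂ) :
    Matrix (Fin (n + 1)) (Fin (n + 1)) ℂ :=
  ξ * Matrix.diagonal (fun i => ((Γ i)⁻¹ : ℂ)) * η -
    η * Matrix.diagonal (fun i => ((Γ i)⁻¹ : ℂ)) * ξ

/-- The inner product `⟨ξ, η⟩ = 2 tr (ξ* η)` on `u(N)`, by which `u(N)_Γ` is identified with its
dual (the trace is real on skew-Hermitian matrices). -/
def pairing {n : ℕ} (ξ η : Matrix (Fin (n + 1)) (Fin (n + 1)) ℂ) : ℝ :=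
  (2 * (ξᴴ * η).trace).re

/-- The basis vector `-(i/√2) e_i e_iᵀ` of `u(N)`. -/
def basisD {n : ℕ} (i : Fin (n + 1)) : Matrix (Fin (n + 1)) (Fin (n + 1)) ℂ :=
  Matrix.single i i (-Complex.I / (√2 : ℝ))

/-- The basis vector `-(i/2) (e_i e_jᵀ + e_j e_iᵀ)` of `u(N)`, for `i < j`. -/
def basisE {n : ℕ} (i j : Fin (n + 1)) : Matrix (Fin (n + 1)) (Fin (n + 1)) ℂ :=
  Matrix.single i j (-Complex.I / 2) + Matrix.single j i (-Complex.I / 2)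

/-- The basis vector `(1/2) (e_i e_jᵀ - e_j e_iᵀ)` of `u(N)`, for `i < j`. -/
def basisF {n : ℕ} (i j : Fin (n + 1)) : Matrix (Fin (n + 1)) (Fin (n + 1)) ℂ :=
  Matrix.single i j (1 / 2) - Matrix.single j i (1 / 2)

/-- The gradient `δf/δλ ∈ u(N)` of a function `f` on `u(N)` with respect to `pairing`, expanded in
the orthonormal basis `basisD i`, `basisE i j`, `basisF i j` (`i < j`). -/
def gradient {n : ℕ} (f : Matrix (Fin (n + 1)) (Fin (n + 1)) ℂ → ℝ)
    (l : Matrix (Fin (n + 1)) (Fin (n + 1)) ℂ) : Matrix (Fin (n + 1)) (Fin (n + 1)) ℂ :=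
  (∑ i, lineDeriv ℝ f l (basisD i) • basisD i) +
    ∑ i, ∑ j ∈ Finset.Ioi i,
      (lineDeriv ℝ f l (basisE i j) • basisE i j + lineDeriv ℝ f l (basisF i j) • basisF i j)

/-- The (minus) Lie–Poisson bracket `{f, h}(λ) = -⟨λ, [δf/δλ, δh/δλ]_Γ⟩` on the dual of
`u(N)_Γ`. -/
def liePoisson {n : ℕ} (Γ : Fin (n + 1) → ℝ)
    (f h : Matrix (Fin (n + 1)) (Fin (n + 1)) ℂ → ℝ)
    (l : Matrix (Fin (n + 1)) (Fin (n + 1)) ℂ) : ℝ :=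
  -pairing l (lieBracket Γ (gradient f l) (gradient h l))

/-! ### The reduction by the torus `T^{N-1}` -/

/-- The coordinate `λ_{ij}` (`i < j`) of `λ ∈ u(N)`: the `(i, j)` entry of `λ` is
`-(i/2) λ_{ij}`. -/
def coord {n : ℕ} (l : Matrix (Fin (n + 1)) (Fin (n + 1)) ℂ) (i j : Fin (n + 1)) : ℂ :=
  2 * Complex.I * l i j

/-- The quotient map by the torus: `λ` is sent to the torus invariants `|λ_{iN}|` and
`μ_{ij} = λ_{ij} conj(λ_{iN}) λ_{jN}`. -/
def quotientMap {n : ℕ} (l : Matrix (Fin (n + 1)) (Fin (n + 1)) ℂ) : ShapeVar n :=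
  (fun i => ‖coord l i.castSucc (Fin.last n)‖,
   fun p => coord l p.1.1.castSucc p.1.2.castSucc *
     (starRingEnd ℂ) (coord l p.1.1.castSucc (Fin.last n)) *
     coord l p.1.2.castSucc (Fin.last n))

/-- The Hermitian matrix with diagonal entries `2`, last column `|λ_{iN}|`, and entries
`μ_{ij} / (|λ_{iN}| |λ_{jN}|)` for `i < j < N`. -/
def hermitianLift {n : ℕ} (ζ : ShapeVar n) : Matrix (Fin (n + 1)) (Fin (n + 1)) ℂ :=
  Matrix.of fun a b =>
    Fin.lastCases (motive := fun _ => ℂ)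
      (Fin.lastCases (motive := fun _ => ℂ) 2 (fun j => (ζ.1 j : ℂ)) b)
      (fun i => Fin.lastCases (motive := fun _ => ℂ) (ζ.1 i : ℂ)
        (fun j =>
          if h : i < j then ζ.2 ⟨(i, j), h⟩ / (ζ.1 i * ζ.1 j)
          else if h : j < i then (starRingEnd ℂ) (ζ.2 ⟨(j, i), h⟩) / (ζ.1 i * ζ.1 j)
          else 2) b) a

/-- The point of `u(N)*` over `ζ` with `λ_i = √2` for all `i` (so that the diagonal entries
`-(i/2) √2 λ_i` are `-i`) and with `λ_{iN} > 0`. -/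
def lift {n : ℕ} (ζ : ShapeVar n) : Matrix (Fin (n + 1)) (Fin (n + 1)) ℂ :=
  (-Complex.I / 2) • hermitianLift ζ

/-- The Poisson bracket of the shape dynamics: the Lie–Poisson bracket of the torus invariant
functions `F ∘ quotientMap` and `G ∘ quotientMap`, on the level set `λ_1 = ⋯ = λ_N = √2` of the
momentum map of the torus action (and of `λ_N`). -/
def shapeBracket {n : ℕ} (Γ : Fin (n + 1) → ℝ) (F G : ShapeVar n → ℝ) (ζ : ShapeVar n) : ℝ :=
  liePoisson Γ (F ∘ quotientMap) (G ∘ quotientMap) (lift ζ)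

/-! ### The shape dynamics -/

/-- The Hamiltonian of the shape dynamics. -/
def shapeHamiltonian {n : ℕ} (R : ℝ) (Γ : Fin (n + 1) → ℝ) (ζ : ShapeVar n) : ℝ :=
  -(1 / (4 * Real.pi * R ^ 2)) *
    ((∑ p : Pairs n, Γ p.1.1.castSucc * Γ p.1.2.castSucc *
        Real.log (R ^ 2 * (4 - ‖ζ.2 p‖ ^ 2 / (ζ.1 p.1.1 ^ 2 * ζ.1 p.1.2 ^ 2)))) +
      Γ (Fin.last n) * ∑ i : Fin n, Γ i.castSucc * Real.log (R ^ 2 * (4 - ζ.1 i ^ 2)))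

/-- The Hamiltonian vector field `ζ ↦ {ζ, H}` of the shape dynamics, in the real coordinates
`|λ_{iN}|`, `Re μ_{ij}`, `Im μ_{ij}`. -/
def shapeField {n : ℕ} (R : ℝ) (Γ : Fin (n + 1) → ℝ) (ζ : ShapeVar n) : ShapeVar n :=
  (fun i => shapeBracket Γ (fun w => w.1 i) (shapeHamiltonian R Γ) ζ,
   fun p => ⟨shapeBracket Γ (fun w => (w.2 p).re) (shapeHamiltonian R Γ) ζ,
     shapeBracket Γ (fun w => (w.2 p).im) (shapeHamiltonian R Γ) ζ⟩)

/-! ### Stability -/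

/-- `γ` is a solution of `ż = v z` in the phase space `S` on the time interval `I`. -/
def IsSolutionOn {E : Type*} [NormedAddCommGroup E] [NormedSpace ℝ E] (v : E → E) (S : Set E)
    (γ : ℝ → E) (I : Set ℝ) : Prop :=
  (∀ t ∈ I, γ t ∈ S) ∧ ∀ t ∈ I, HasDerivWithinAt γ (v (γ t)) I t

/-- `z` is a (Lyapunov) stable equilibrium of `ż = v z` in the phase space `S`: it is a zero of
`v`, and for every `ε > 0` there is `δ > 0` such that from every initial point of `S` within `δ`
of `z` there starts a solution for all times `t ≥ 0`, and every solution that starts there,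
on whatever interval `[0, T)` it is defined, stays within `ε` of `z`. -/
def IsStableEquilibrium {E : Type*} [NormedAddCommGroup E] [NormedSpace ℝ E] (v : E → E)
    (S : Set E) (z : E) : Prop :=
  z ∈ S ∧ v z = 0 ∧ ∀ ε > 0, ∃ δ > 0, ∀ z₀ ∈ S, dist z₀ z < δ →
    (∃ γ : ℝ → E, γ 0 = z₀ ∧ IsSolutionOn v S γ (Set.Ici 0)) ∧
    ∀ (T : ℝ) (γ : ℝ → E), γ 0 = z₀ → IsSolutionOn v S γ (Set.Ico 0 T) →
      ∀ t ∈ Set.Ico 0 T, dist (γ t) z < ε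

/-! ### The shape of a configuration on the sphere -/

/-- `|λ_{ij}|² = 4 - ℓ_{ij}² / R²`, with `ℓ_{ij}` the Euclidean distance of the vortices
`i` and `j`. -/
def normSqCoord {n : ℕ} (R : ℝ) (x : Fin (n + 1) → EuclideanSpace ℝ (Fin 3))
    (i j : Fin (n + 1)) : ℝ :=
  4 - ‖x i - x j‖ ^ 2 / R ^ 2

/-- The signed volume `V_{ijk} = x_i ⬝ (x_j × x_k)`. -/
def signedVolume {n : ℕ} (x : Fin (n + 1) → EuclideanSpace ℝ (Fin 3))
    (i j k : Fin (n + 1)) : ℝ :=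
  (x i).ofLp ⬝ᵥ (crossProduct (x j).ofLp (x k).ofLp)

/-- The shape variables of the configuration `x` of vortices on the sphere of radius `R`:
`|λ_{iN}| = √(4 - ℓ_{iN}² / R²)`, `Re μ_{ij} = |λ_{ij}|² + |λ_{iN}|² + |λ_{jN}|² - 4` and
`Im μ_{ij} = 2 V_{ijN} / R³`. -/
def shapeOf {n : ℕ} (R : ℝ) (x : Fin (n + 1) → EuclideanSpace ℝ (Fin 3)) : ShapeVar n :=
  (fun i => √(normSqCoord R x i.castSucc (Fin.last n)),
   fun p =>
     ⟨normSqCoord R x p.1.1.castSucc p.1.2.castSucc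
        + normSqCoord R x p.1.1.castSucc (Fin.last n)
        + normSqCoord R x p.1.2.castSucc (Fin.last n) - 4,
      2 / R ^ 3 * signedVolume x p.1.1.castSucc p.1.2.castSucc (Fin.last n)⟩)

/-- A regular tetrahedron inscribed in the sphere of radius `R` about the origin: all six
inter-vortex distances are `2 √(2/3) R`. -/
def IsTetrahedron (R : ℝ) (x : Fin 4 → EuclideanSpace ℝ (Fin 3)) : Prop :=
  (∀ i, ‖x i‖ = R) ∧ ∀ i j, i ≠ j → ‖x i - x j‖ = 2 * √(2 / 3) * R

end VortexShape

end

/-! The energy alone has no reason to be extremal at the tetrahedron, but the Casimirs of the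
bracket can be added to it. Let $\Lambda$ be the Hermitian matrix over $\zeta$ and
$M=D_\Gamma\Lambda$. Hamiltonian motion on $\mathfrak u(4)_\Gamma^*$ moves $M$ by a commutator, so
every $\operatorname{tr}M^k$ is conserved (`fderiv_casimir_hamiltonianField`). The Lyapunov function
is, up to a constant, $4\pi R^2\mathcal
H-\tfrac3{16}\operatorname{tr}M^2+\operatorname{tr}(M^3-pM^2+qM)^2$.

Take all circulations positive, and write $s_{ij}=|\lambda_{ij}|^2$. The first two terms are, up to
a constant, $-\sum\Gamma_i\Gamma_j(\ln(4-s_{ij})+\tfrac38s_{ij})$. By concavity of the logarithm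
this is minimal exactly when all $s_{ij}=4/3$ (`logSum_le`). It does not see the arguments of the
$\mu_{ij}$; the third term does. Since $M$ is similar to the Hermitian matrix $D_\Gamma^{1/2}\Lambda
D_\Gamma^{1/2}$, that term is a squared Frobenius norm. It vanishes at the tetrahedron, where $M$
has rank two and $p,q$ are the trace and the product of its nonzero eigenvalues.

If both parts are minimal, then $M^3-pM^2+qM=0$, which makes $\Lambda$ positive semidefinite, so its
$3\times3$ principal minors $2\operatorname{Re}(\lambda_{ab}\lambda_{bc}\lambda_{ca})$ are
nonnegative. The trace of the same equation says that a positive combination of them is zero, so all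
vanish (`triple_re_eq_zero`). Hence $\operatorname{Re}\mu_{ij}=0$ and
$(\operatorname{Im}\mu_{ij})^2=64/27$, which isolates the tetrahedron once the signs are fixed
(`lyapunov_pos`). A conserved quantity with a strict local minimum gives stability
(`isStableEquilibrium_of_conserved`). Negative circulations reduce to positive ones by time reversal
(`shapeField_neg`). -/

noncomputable section

namespace VortexShape

open Metric Set Filter Topology
open scoped NNReal

/-! ### Lyapunov stability from a conserved quantity with a strict minimum -/

section LyapunovStability

variable {E : Type*} [NormedAddCommGroup E] [NormedSpace ℝ E]

/-- A curve starting close to a strict local minimum of `V`, along which `V` is constant as long as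
it stays in a given ball, never leaves that ball. -/
lemma exists_delta_trapping [ProperSpace E] {v : E → E} {V : E → ℝ} {z : E} {r : ℝ}
    (hr : 0 < r) (hVd : ∀ x ∈ closedBall z r, DifferentiableAt ℝ V x)
    (hVv : ∀ x ∈ closedBall z r, fderiv ℝ V x (v x) = 0) (hVz : V z = 0)
    (hVpos : ∀ x ∈ closedBall z r, x ≠ z → 0 < V x) :
    ∃ δ > 0, δ ≤ r ∧ ∀ (γ : ℝ → E) (I : Set ℝ), dist (γ 0) z < δ → I ⊆ Ici 0 →
      (∀ t ∈ I, Icc 0 t ⊆ I) → (∀ t ∈ I, HasDerivWithinAt γ (v (γ t)) I t) →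
      ∀ t ∈ I, dist (γ t) z < r := by
  -- The barrier height is the minimum of `V` on the compact sphere. In the zero space the sphere is
  -- empty and any positive number serves.
  obtain ⟨m, hm, hmV⟩ : ∃ m > 0, ∀ x ∈ sphere z r, m ≤ V x := by
    rcases (sphere z r).eq_empty_or_nonempty with he | hne
    · exact ⟨1, one_pos, by simp [he]⟩
    · obtain ⟨y, hy, hmin⟩ := (isCompact_sphere z r).exists_isMinOn hne
        (fun x hx => (hVd x (sphere_subset_closedBall hx)).continuousAt.continuousWithinAt)
      refine ⟨V y, hVpos y (sphere_subset_closedBall hy) ?_, fun x hx => hmin hx⟩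
      rintro rfl
      simp [hr.ne] at hy
  have hcz : ContinuousAt V z := (hVd z (mem_closedBall_self hr.le)).continuousAt
  obtain ⟨δ, hδ, hδV⟩ := Metric.mem_nhds_iff.1
    (hcz.eventually_lt (continuousAt_const (y := m)) (by rw [hVz]; exact hm))
  refine ⟨min δ r, lt_min hδ hr, min_le_right _ _, fun γ I hγ0 hI0 hI hγ t₁ ht₁ => ?_⟩
  by_contra! hfar
  have hcont : ContinuousOn γ (Icc 0 t₁) := fun t ht =>
    ((hγ t (hI t₁ ht₁ ht)).continuousWithinAt).mono (hI t₁ ht₁)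
  have hdist : ContinuousOn (fun t => dist (γ t) z) (Icc 0 t₁) :=
    fun t ht => (hcont t ht).dist continuousWithinAt_const
  have hclosed : IsClosed (Icc 0 t₁ ∩ (fun t => dist (γ t) z) ⁻¹' Ici r) :=
    hdist.preimage_isClosed_of_isClosed isClosed_Icc isClosed_Ici
  have hcomp : IsCompact (Icc 0 t₁ ∩ (fun t => dist (γ t) z) ⁻¹' Ici r) :=
    isCompact_Icc.of_isClosed_subset hclosed inter_subset_left
  -- `s` is the first time at distance at least `r`. Up to `s` the curve lies in the closed ball, so
  -- `V` keeps its initial value, which is below `m`, while `γ s` lies on the sphere.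
  obtain ⟨s, ⟨hs, hsr⟩, hleast⟩ := hcomp.exists_isLeast ⟨t₁, ⟨hI0 ht₁, le_rfl⟩, hfar⟩
  have hbefore : ∀ t ∈ Ico 0 s, dist (γ t) z < r := by
    intro t ht
    by_contra! h
    exact absurd (hleast ⟨⟨ht.1, ht.2.le.trans hs.2⟩, h⟩) (not_le.2 ht.2)
  have hs0 : 0 < s := by
    rcases hs.1.lt_or_eq with h | h
    · exact h
    · rw [← h] at hsr
      exact absurd (hγ0.trans_le (min_le_right _ _)) (not_lt.2 hsr)
  have hs_eq : dist (γ s) z = r := by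
    refine le_antisymm ?_ hsr
    have hc : ContinuousWithinAt (fun t => dist (γ t) z) (Ico 0 s) s :=
      (hdist s hs).mono (fun t ht => ⟨ht.1, ht.2.le.trans hs.2⟩)
    have hne : (𝓝[Ico 0 s] s).NeBot := by
      rw [← mem_closure_iff_nhdsWithin_neBot, closure_Ico hs0.ne]
      exact ⟨hs0.le, le_rfl⟩
    exact le_of_tendsto hc (eventually_mem_nhdsWithin.mono fun t ht => (hbefore t ht).le)
  have hball : ∀ t ∈ Icc 0 s, γ t ∈ closedBall z r := by
    intro t ht
    rcases ht.2.lt_or_eq with h | h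
    · exact (hbefore t ⟨ht.1, h⟩).le
    · rw [h]; exact hs_eq.le
  have hsub : Icc 0 s ⊆ I := (Icc_subset_Icc_right hs.2).trans (hI t₁ ht₁)
  have hderiv : ∀ t ∈ Icc 0 s, HasDerivWithinAt (V ∘ γ) 0 (Icc 0 s) t := by
    intro t ht
    have := ((hVd _ (hball t ht)).hasFDerivAt).comp_hasDerivWithinAt t
      ((hγ t (hsub ht)).mono hsub)
    rwa [hVv _ (hball t ht)] at this
  have hVs : V (γ s) = V (γ 0) :=
    constant_of_derivWithin_zero (fun t ht => (hderiv t ht).differentiableWithinAt)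
      (fun t ht => (hderiv t ⟨ht.1, ht.2.le⟩).derivWithin
        (uniqueDiffOn_Icc hs0 t ⟨ht.1, ht.2.le⟩)) s ⟨hs0.le, le_rfl⟩
  have h1 : V (γ 0) < m := hδV (hγ0.trans_le (min_le_left _ _))
  have h2 : m ≤ V (γ s) := hmV _ hs_eq
  linarith

/-- A bounded, globally Lipschitz vector field has forward solutions for all times. -/
lemma exists_global_solution [CompleteSpace E] {v : E → E} {K L : ℝ≥0} (hK : LipschitzWith K v)
    (hL : ∀ x, ‖v x‖ ≤ L) (x₀ : E) :
    ∃ γ : ℝ → E, γ 0 = x₀ ∧ ∀ t ∈ Ici (0 : ℝ), HasDerivWithinAt γ (v (γ t)) (Ici 0) t := by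
  have hex : ∀ n : ℕ, ∃ α : ℝ → E, α 0 = x₀ ∧
      ∀ t ∈ Icc (0 : ℝ) n, HasDerivWithinAt α (v (α t)) (Icc (0 : ℝ) n) t := by
    intro n
    -- With speed at most `L`, a ball of radius `L * n` cannot be left before time `n`; hence the
    -- solution exists on all of `[0, n]`.
    have hpl : IsPicardLindelof (fun _ => v) (tmin := 0) (tmax := n)
        ⟨0, le_rfl, n.cast_nonneg⟩ x₀ (L * n) 0 L K :=
      IsPicardLindelof.of_time_independent (fun x _ => hL x) (hK.lipschitzOnWith) (by simp)
    exact hpl.exists_eq_forall_mem_Icc_hasDerivWithinAt₀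
  choose α hα0 hα using hex
  have hagree : ∀ m n : ℕ, m ≤ n → EqOn (α m) (α n) (Icc (0 : ℝ) m) := by
    intro m n hmn
    have hmn' : (m : ℝ) ≤ n := by exact_mod_cast hmn
    have key : ∀ k : ℕ, m ≤ k → (ContinuousOn (α k) (Icc (0 : ℝ) m)) ∧
        ∀ t ∈ Ico (0 : ℝ) m, HasDerivWithinAt (α k) (v (α k t)) (Ici t) t := by
      intro k hk
      have hk' : (m : ℝ) ≤ k := by exact_mod_cast hk
      refine ⟨fun t ht => ((hα k t ⟨ht.1, ht.2.trans hk'⟩).continuousWithinAt).mono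
        (Icc_subset_Icc_right hk'), fun t ht => ?_⟩
      refine (hα k t ⟨ht.1, ht.2.le.trans hk'⟩).mono_of_mem_nhdsWithin ?_
      exact mem_of_superset (Icc_mem_nhdsGE (ht.2.trans_le hk')) (Icc_subset_Icc_left ht.1)
    exact ODE_solution_unique (v := fun _ => v) (fun _ => hK) (key m le_rfl).1 (key m le_rfl).2
      (key n hmn).1 (key n hmn).2 (by rw [hα0, hα0])
  have hagree' : ∀ m n : ℕ, ∀ t : ℝ, 0 ≤ t → t ≤ m → t ≤ n → α m t = α n t := by
    intro m n t h0 hm hn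
    rcases le_total m n with h | h
    · exact hagree m n h ⟨h0, hm⟩
    · exact (hagree n m h ⟨h0, hn⟩).symm
  -- The `+ 1` puts `t` strictly below the end of the interval of the chosen solution, so that
  -- solution covers a full neighbourhood of `t` in `Ici 0`.
  refine ⟨fun t => α (⌊t⌋₊ + 1) t, by simp [hα0], fun t ht => ?_⟩
  have hlt : t < ((⌊t⌋₊ + 1 : ℕ) : ℝ) := by exact_mod_cast Nat.lt_floor_add_one t
  have h1 : HasDerivWithinAt (α (⌊t⌋₊ + 1)) (v (α (⌊t⌋₊ + 1) t)) (Ici 0) t := by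
    refine (hα _ t ⟨ht, hlt.le⟩).mono_of_mem_nhdsWithin ?_
    rw [← Ici_inter_Iic]
    exact inter_mem_nhdsWithin _ (Iic_mem_nhds hlt)
  refine h1.congr_of_eventuallyEq ?_ rfl
  filter_upwards [self_mem_nhdsWithin, mem_nhdsWithin_of_mem_nhds (Iio_mem_nhds hlt)] with s hs hs'
  exact hagree' _ _ s hs (by exact_mod_cast (Nat.lt_floor_add_one s).le) (mem_Iio.1 hs').le

/-- Lyapunov's theorem for a conserved quantity with a strict minimum. -/
theorem isStableEquilibrium_of_conserved [FiniteDimensional ℝ E] {v : E → E} {S : Set E} {V : E → ℝ}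
    {z : E} {r : ℝ} (hr : 0 < r) (hS : closedBall z r ⊆ S)
    (hv : ∀ x ∈ closedBall z r, ContDiffAt ℝ 1 v x)
    (hVd : ∀ x ∈ closedBall z r, DifferentiableAt ℝ V x)
    (hVv : ∀ x ∈ closedBall z r, fderiv ℝ V x (v x) = 0) (hVz : V z = 0)
    (hVpos : ∀ x ∈ closedBall z r, x ≠ z → 0 < V x) :
    IsStableEquilibrium v S z := by
  have : ProperSpace E := FiniteDimensional.proper_real E
  have : CompleteSpace E := FiniteDimensional.complete ℝ E
  have hstab : ∀ ε > 0, ∃ δ > 0, ∀ z₀ ∈ S, dist z₀ z < δ →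
      (∃ γ : ℝ → E, γ 0 = z₀ ∧ IsSolutionOn v S γ (Ici 0)) ∧
      ∀ (T : ℝ) (γ : ℝ → E), γ 0 = z₀ → IsSolutionOn v S γ (Ico 0 T) →
        ∀ t ∈ Ico 0 T, dist (γ t) z < ε := by
    intro ε₀ hε₀
    obtain ⟨ε, hε, hεε₀, hεr⟩ : ∃ ε > 0, ε ≤ ε₀ ∧ ε < r :=
      ⟨min ε₀ (r / 2), lt_min hε₀ (half_pos hr), min_le_left _ _,
        (min_le_right _ _).trans_lt (half_lt_self hr)⟩
    have hsub : closedBall z ε ⊆ closedBall z r := closedBall_subset_closedBall hεr.le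
    -- Cutting `v` off outside the ball of radius `r` makes it globally Lipschitz and bounded
    -- without changing it on the ball of radius `ε`. `V` is still conserved, since the direction is
    -- only rescaled, so solutions of the cut-off field are trapped where the two fields agree.
    let χ : ContDiffBump z := ⟨ε, r, hε, hεr⟩
    have hw : ContDiff ℝ 1 (fun x => χ x • v x) := by
      rw [contDiff_iff_contDiffAt]
      intro x
      by_cases hx : x ∈ closedBall z r
      · exact χ.contDiff.contDiffAt.smul (hv x hx)
      · have hx' : x ∉ tsupport χ := by rwa [χ.tsupport_eq]
        refine (contDiffAt_const (c := (0 : E))).congr_of_eventuallyEq ?_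
        filter_upwards [(notMem_tsupport_iff_eventuallyEq).1 hx'] with y hy
        simp [hy]
    have hwc : HasCompactSupport (fun x => χ x • v x) := χ.hasCompactSupport.smul_right
    obtain ⟨K, hK⟩ := hw.lipschitzWith_of_hasCompactSupport hwc one_ne_zero
    obtain ⟨L, hL⟩ := hwc.exists_bound_of_continuous hw.continuous
    obtain ⟨δ₁, hδ₁, -, htrap₁⟩ := exists_delta_trapping hε (fun x hx => hVd x (hsub hx))
      (fun x hx => hVv x (hsub hx)) hVz (fun x hx => hVpos x (hsub hx))
    obtain ⟨δ₂, hδ₂, -, htrap₂⟩ := exists_delta_trapping (v := fun x => χ x • v x) hε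
      (fun x hx => hVd x (hsub hx))
      (fun x hx => by rw [map_smul, hVv x (hsub hx), smul_zero]) hVz
      (fun x hx => hVpos x (hsub hx))
    refine ⟨min δ₁ δ₂, lt_min hδ₁ hδ₂, fun z₀ _ hz₀ => ⟨?_, fun T γ hγ0 hγ t ht => ?_⟩⟩
    · obtain ⟨γ, hγ0, hγ⟩ := exists_global_solution (L := L.toNNReal) hK
        (fun x => (hL x).trans (Real.le_coe_toNNReal L)) z₀
      have hin : ∀ t ∈ Ici (0 : ℝ), dist (γ t) z < ε :=
        htrap₂ γ (Ici 0) (by rw [hγ0]; exact hz₀.trans_le (min_le_right _ _)) subset_rfl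
          (fun t _ => Icc_subset_Ici_self) hγ
      refine ⟨γ, hγ0, fun t ht => hS (hsub (hin t ht).le), fun t ht => ?_⟩
      have := hγ t ht
      rwa [χ.one_of_mem_closedBall (hin t ht).le, one_smul] at this
    · exact (htrap₁ γ (Ico 0 T) (by rw [hγ0]; exact hz₀.trans_le (min_le_left _ _))
        (fun s hs => hs.1) (fun s hs u hu => ⟨hu.1, hu.2.trans_lt hs.2⟩) hγ.2 t ht).trans_le hεε₀
  have hzS : z ∈ S := hS (mem_closedBall_self hr.le)
  refine ⟨hzS, ?_, hstab⟩
  -- That `v z = 0` follows from stability itself: the solution from `z` stays within every `ε` of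
  -- `z`, hence is constant.
  obtain ⟨δ₀, hδ₀, h₀⟩ := hstab 1 one_pos
  obtain ⟨γ, hγ0, hγ⟩ := (h₀ z hzS (by simpa using hδ₀)).1
  have hconst : ∀ t ∈ Ici (0 : ℝ), γ t = z := by
    intro t ht
    refine eq_of_forall_dist_le fun ε hε => ?_
    obtain ⟨δ, hδ, h⟩ := hstab ε hε
    have hsub : Ico 0 (t + 1) ⊆ Ici (0 : ℝ) := fun s hs => hs.1
    exact ((h z hzS (by simpa using hδ)).2 (t + 1) γ hγ0
      ⟨fun s hs => hγ.1 s (hsub hs), fun s hs => (hγ.2 s (hsub hs)).mono hsub⟩ t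
      ⟨ht, lt_add_one t⟩).le
  have h0 : (0 : ℝ) ∈ Ici (0 : ℝ) := self_mem_Ici
  have hd := hγ.2 0 h0
  rw [hγ0] at hd
  exact (uniqueDiffOn_Ici 0 0 h0).eq_deriv _ hd
    ((hasDerivWithinAt_const 0 (Ici 0) z).congr hconst hγ0)

end LyapunovStability

variable {n : ℕ}

/-! ### The gradient -/

/-- The element of `u(N)` that represents a real linear functional with respect to `pairing`. -/
def dualVector (L : Matrix (Fin (n + 1)) (Fin (n + 1)) ℂ → ℝ) :
    Matrix (Fin (n + 1)) (Fin (n + 1)) ℂ :=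
  (∑ i, L (basisD i) • basisD i) +
    ∑ i, ∑ j ∈ Finset.Ioi i, (L (basisE i j) • basisE i j + L (basisF i j) • basisF i j)

lemma basisD_conjTranspose (i : Fin (n + 1)) : (basisD i)ᴴ = -basisD i := by
  simp [basisD, Matrix.conjTranspose_single, neg_div, ← Matrix.single_neg]

lemma basisE_conjTranspose (i j : Fin (n + 1)) : (basisE i j)ᴴ = -basisE i j := by
  simp [basisE, Matrix.conjTranspose_single, neg_div, ← Matrix.single_neg, add_comm]

lemma basisF_conjTranspose (i j : Fin (n + 1)) : (basisF i j)ᴴ = -basisF i j := by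
  simp [basisF, Matrix.conjTranspose_single]

lemma dualVector_conjTranspose (L : Matrix (Fin (n + 1)) (Fin (n + 1)) ℂ → ℝ) :
    (dualVector L)ᴴ = -dualVector L := by
  simp only [dualVector, Matrix.conjTranspose_add, Matrix.conjTranspose_sum,
    Matrix.conjTranspose_smul, basisD_conjTranspose, basisE_conjTranspose, basisF_conjTranspose,
    star_trivial, smul_neg, ← neg_add, Finset.sum_neg_distrib]

lemma pairing_comm (ξ η : Matrix (Fin (n + 1)) (Fin (n + 1)) ℂ) : pairing ξ η = pairing η ξ := by
  have : (ηᴴ * ξ).trace = star ((ξᴴ * η).trace) := by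
    rw [← Matrix.trace_conjTranspose, Matrix.conjTranspose_mul, Matrix.conjTranspose_conjTranspose]
  simp [pairing, this]

/-- `pairing ξ` as a linear map. -/
def pairingLin (ξ : Matrix (Fin (n + 1)) (Fin (n + 1)) ℂ) :
    Matrix (Fin (n + 1)) (Fin (n + 1)) ℂ →ₗ[ℝ] ℝ where
  toFun := pairing ξ
  map_add' a b := by simp [pairing, mul_add]
  map_smul' c a := by simp [pairing]; ring

/-- The vectors `basisD`, `basisE`, `basisF` are an orthonormal basis of the skew-Hermitian
matrices, and this is the expansion in it. The `E` and `F` terms of a pair together rebuild its two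
off-diagonal entries. -/
lemma skewHermitian_expansion {Z : Matrix (Fin (n + 1)) (Fin (n + 1)) ℂ} (hZ : Zᴴ = -Z) :
    Z = dualVector (pairing Z) := by
  have hent : ∀ a b, star (Z b a) = -Z a b := fun a b => by
    simpa using congrFun (congrFun hZ a) b
  have hre : ∀ a b, (Z b a).re = -(Z a b).re := fun a b => by
    simpa using congrArg Complex.re (hent a b)
  have him : ∀ a b, (Z b a).im = (Z a b).im := fun a b => by
    simpa using congrArg Complex.im (hent a b)
  have hD : ∀ i, pairing Z (basisD i) • basisD i = Matrix.single i i (Z i i) := by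
    intro i
    have h2 : (√2 : ℝ) ^ 2 = 2 := Real.sq_sqrt (by norm_num)
    have h0 : (Z i i).re = 0 := by linarith [hre i i]
    have hp : pairing Z (basisD i) = -2 * (Z i i).im / √2 := by
      simp only [pairing, hZ, Matrix.neg_mul, Matrix.trace_neg, basisD, Matrix.trace_mul_single,
        op_smul_eq_mul]
      rw [show (2 : ℂ) * -(Z i i * (-Complex.I / (√2 : ℝ))) = Complex.I * Z i i * (2 / √2 : ℝ) by
        push_cast; ring, Complex.re_mul_ofReal]
      simp only [Complex.mul_re, Complex.I_re, Complex.I_im]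
      ring
    rw [hp, basisD, Matrix.smul_single]
    congr 1
    have hs : √2 ≠ 0 := by positivity
    apply Complex.ext
    · simp [h0, Complex.div_ofReal_re]
    · simp only [Complex.real_smul, Complex.im_ofReal_mul,
        Complex.div_ofReal_im, Complex.neg_im, Complex.I_im]
      field_simp
      linear_combination (-(Z i i).im) * h2
  have hEF : ∀ i j, pairing Z (basisE i j) • basisE i j + pairing Z (basisF i j) • basisF i j
      = Matrix.single j i (Z j i) + Matrix.single i j (Z i j) := by
    intro i j
    have hE : pairing Z (basisE i j) = -2 * (Z i j).im := by
      simp [pairing, hZ, basisE, Matrix.mul_add, Matrix.trace_mul_single, him j i]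
      ring
    have hF : pairing Z (basisF i j) = 2 * (Z i j).re := by
      simp [pairing, hZ, basisF, Matrix.mul_sub, Matrix.trace_mul_single, hre i j]
      ring
    have h1 : Z i j = (Z i j).re + (Z i j).im * Complex.I := (Complex.re_add_im _).symm
    have h2 : Z j i = -(Z i j).re + (Z i j).im * Complex.I := by
      rw [← Complex.re_add_im (Z j i), hre i j, him i j]; push_cast; ring
    have hab : ∀ a b c d : Matrix (Fin (n + 1)) (Fin (n + 1)) ℂ,
        a + b + (c - d) = (b - d) + (a + c) := fun a b c d => by abel
    have hsub : ∀ c d : ℂ, Matrix.single j i c - Matrix.single j i d = Matrix.single j i (c - d) :=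
      fun c d => by rw [sub_eq_add_neg, Matrix.single_neg, ← Matrix.single_add, ← sub_eq_add_neg]
    rw [hE, hF, basisE, basisF, smul_add, smul_sub, Matrix.smul_single, Matrix.smul_single,
      Matrix.smul_single, Matrix.smul_single, hab, ← Matrix.single_add, hsub]
    congr 2
    · rw [h2]; simp; ring
    · simp
      linear_combination -h1
  conv_lhs => rw [Matrix.matrix_eq_sum_single Z]
  simp only [dualVector, hD, hEF]
  rw [Finset.sum_sum_Ioi_add_eq_sum_sum_off_diag (fun i j => Matrix.single i j (Z i j)),
    ← Finset.sum_add_distrib, Finset.sum_comm]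
  refine Finset.sum_congr rfl fun i _ => ?_
  rw [Fintype.sum_eq_add_sum_compl i]

/-- The Riesz property, which frees the gradient from the basis. It needs a skew-Hermitian `Z`,
because the basis spans only those matrices. -/
lemma pairing_dualVector (L : Matrix (Fin (n + 1)) (Fin (n + 1)) ℂ →ₗ[ℝ] ℝ)
    {Z : Matrix (Fin (n + 1)) (Fin (n + 1)) ℂ} (hZ : Zᴴ = -Z) :
    pairing (dualVector L) Z = L Z := by
  conv_rhs => rw [skewHermitian_expansion hZ]
  rw [pairing_comm]
  change pairingLin Z _ = _
  simp only [dualVector, map_add, map_sum, map_smul, smul_eq_mul]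
  simp only [pairingLin, LinearMap.coe_mk, AddHom.coe_mk, mul_comm]

/-! ### The Hamiltonian vector field on `u(N)*` -/

/-- The Hamiltonian vector field at `l` of a function with gradient `η`. -/
def hamiltonianVector (Γ : Fin (n + 1) → ℝ) (l η : Matrix (Fin (n + 1)) (Fin (n + 1)) ℂ) :
    Matrix (Fin (n + 1)) (Fin (n + 1)) ℂ :=
  l * η * Matrix.diagonal (fun i => ((Γ i)⁻¹ : ℂ)) -
    Matrix.diagonal (fun i => ((Γ i)⁻¹ : ℂ)) * η * l

lemma hamiltonianVector_conjTranspose (Γ : Fin (n + 1) → ℝ)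
    {l η : Matrix (Fin (n + 1)) (Fin (n + 1)) ℂ} (hl : lᴴ = -l) (hη : ηᴴ = -η) :
    (hamiltonianVector Γ l η)ᴴ = -hamiltonianVector Γ l η := by
  have hD : (Matrix.diagonal (fun i => ((Γ i)⁻¹ : ℂ)))ᴴ = Matrix.diagonal (fun i => ((Γ i)⁻¹ : ℂ)) := by
    rw [Matrix.diagonal_conjTranspose]
    congr 1
    ext i
    simp
  simp only [hamiltonianVector, Matrix.conjTranspose_sub, Matrix.conjTranspose_mul, hD, hl, hη]
  noncomm_ring

/-- Cyclicity of the trace isolates `ξ`, so the Lie–Poisson bracket becomes a derivative along a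
vector field that depends only on the second function. -/
lemma neg_pairing_lieBracket (Γ : Fin (n + 1) → ℝ)
    {l ξ η : Matrix (Fin (n + 1)) (Fin (n + 1)) ℂ} (hl : lᴴ = -l) (hξ : ξᴴ = -ξ) :
    -pairing l (lieBracket Γ ξ η) = pairing ξ (hamiltonianVector Γ l η) := by
  set D := Matrix.diagonal (fun i => ((Γ i)⁻¹ : ℂ)) with hD
  have h1 : (l * (ξ * D * η)).trace = (ξ * (D * η * l)).trace := by
    rw [Matrix.trace_mul_comm]; simp only [Matrix.mul_assoc]
  have h2 : (l * (η * D * ξ)).trace = (ξ * (l * η * D)).trace := by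
    rw [← Matrix.mul_assoc, Matrix.trace_mul_comm]; simp only [Matrix.mul_assoc]
  simp only [pairing, lieBracket, hamiltonianVector, ← hD, hl, hξ, Matrix.neg_mul, Matrix.mul_sub,
    Matrix.trace_neg, Matrix.trace_sub, h1, h2]
  simp only [Complex.mul_re, Complex.neg_re, Complex.sub_re, Complex.sub_im, Complex.neg_im,
    Complex.re_ofNat, Complex.im_ofNat]
  ring

/-- The topology of the entrywise sup norm. -/
abbrev supTopology : TopologicalSpace (Matrix (Fin (n + 1)) (Fin (n + 1)) ℂ) :=
  Matrix.normedAddCommGroup.toPseudoMetricSpace.toUniformSpace.toTopologicalSpace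

section Calculus

attribute [local instance] Matrix.normedAddCommGroup Matrix.normedSpace supTopology

lemma gradient_eq_dualVector {f : Matrix (Fin (n + 1)) (Fin (n + 1)) ℂ → ℝ}
    {f' : Matrix (Fin (n + 1)) (Fin (n + 1)) ℂ →L[ℝ] ℝ} {l : Matrix (Fin (n + 1)) (Fin (n + 1)) ℂ}
    (hf : HasFDerivAt f f' l) : gradient f l = dualVector f' := by
  simp only [gradient, dualVector, (hf.hasLineDerivAt _).lineDeriv]

end Calculus

/-! ### The quotient map and its section -/

@[simp] lemma hermitianLift_last_last (ζ : ShapeVar n) :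
    hermitianLift ζ (Fin.last n) (Fin.last n) = 2 := by
  simp [hermitianLift]

@[simp] lemma hermitianLift_castSucc_last (ζ : ShapeVar n) (i : Fin n) :
    hermitianLift ζ i.castSucc (Fin.last n) = ζ.1 i := by
  simp [hermitianLift]

@[simp] lemma hermitianLift_last_castSucc (ζ : ShapeVar n) (i : Fin n) :
    hermitianLift ζ (Fin.last n) i.castSucc = ζ.1 i := by
  simp [hermitianLift]

lemma hermitianLift_castSucc_castSucc (ζ : ShapeVar n) (i j : Fin n) :
    hermitianLift ζ i.castSucc j.castSucc =
      if h : i < j then ζ.2 ⟨(i, j), h⟩ / (ζ.1 i * ζ.1 j)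
      else if h : j < i then (starRingEnd ℂ) (ζ.2 ⟨(j, i), h⟩) / (ζ.1 i * ζ.1 j)
      else 2 := by
  simp [hermitianLift]

lemma hermitianLift_diag (ζ : ShapeVar n) (a : Fin (n + 1)) : hermitianLift ζ a a = 2 := by
  induction a using Fin.lastCases with
  | last => simp
  | cast i => simp [hermitianLift_castSucc_castSucc]

lemma isHermitian_hermitianLift (ζ : ShapeVar n) : (hermitianLift ζ).IsHermitian := by
  ext a b
  rw [Matrix.conjTranspose_apply]
  induction a using Fin.lastCases with
  | last => induction b using Fin.lastCases <;> simp
  | cast i =>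
    induction b using Fin.lastCases with
    | last => simp
    | cast j =>
      rw [hermitianLift_castSucc_castSucc, hermitianLift_castSucc_castSucc]
      rcases lt_trichotomy i j with h | rfl | h
      · simp [h, h.not_gt, mul_comm]
      · simp
      · simp [h, h.not_gt, mul_comm]

lemma lift_conjTranspose (ζ : ShapeVar n) : (lift ζ)ᴴ = -lift ζ := by
  rw [lift, Matrix.conjTranspose_smul, (isHermitian_hermitianLift ζ).eq, ← neg_smul]
  congr 1
  simp [neg_div]

lemma coord_lift (ζ : ShapeVar n) (a b : Fin (n + 1)) :
    coord (lift ζ) a b = hermitianLift ζ a b := by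
  simp only [coord, lift, Matrix.smul_apply, smul_eq_mul]
  linear_combination (-hermitianLift ζ a b) * Complex.I_mul_I

lemma quotientMap_lift {ζ : ShapeVar n} (hζ : ∀ i, 0 < ζ.1 i) : quotientMap (lift ζ) = ζ := by
  refine Prod.ext (funext fun i => ?_) (funext fun p => ?_)
  · simp [quotientMap, coord_lift, abs_of_pos (hζ i)]
  · have h1 : (ζ.1 p.1.1 : ℂ) ≠ 0 := by exact_mod_cast (hζ _).ne'
    have h2 : (ζ.1 p.1.2 : ℂ) ≠ 0 := by exact_mod_cast (hζ _).ne'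
    simp only [quotientMap, coord_lift, hermitianLift_castSucc_castSucc, p.2, dite_true,
      hermitianLift_castSucc_last, Complex.conj_ofReal]
    field_simp

/-! ### Smoothness of the reduction and the Hamiltonian field on the shape space -/

section Calculus

attribute [local instance] Matrix.normedAddCommGroup Matrix.normedSpace supTopology

lemma contDiff_entry (a b : Fin (n + 1)) {k : WithTop ℕ∞} :
    ContDiff ℝ k (fun l : Matrix (Fin (n + 1)) (Fin (n + 1)) ℂ => l a b) :=
  contDiff_apply_apply ℝ ℂ a b

lemma contDiffAt_matrix_iff {E : Type*} [NormedAddCommGroup E] [NormedSpace ℝ E]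
    {f : E → Matrix (Fin (n + 1)) (Fin (n + 1)) ℂ} {x : E} {k : WithTop ℕ∞} :
    ContDiffAt ℝ k f x ↔ ∀ a b, ContDiffAt ℝ k (fun y => f y a b) x := by
  refine contDiffAt_pi.trans (forall_congr' fun a => contDiffAt_pi)

lemma ContDiffAt.matrix_mul {E : Type*} [NormedAddCommGroup E] [NormedSpace ℝ E]
    {f g : E → Matrix (Fin (n + 1)) (Fin (n + 1)) ℂ} {x : E} {k : WithTop ℕ∞}
    (hf : ContDiffAt ℝ k f x) (hg : ContDiffAt ℝ k g x) :
    ContDiffAt ℝ k (fun y => f y * g y) x := by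
  rw [contDiffAt_matrix_iff] at *
  intro a b
  simp only [Matrix.mul_apply]
  exact ContDiffAt.sum fun c _ => (hf a c).mul (hg c b)

lemma contDiff_coord (a b : Fin (n + 1)) {k : WithTop ℕ∞} :
    ContDiff ℝ k (fun l : Matrix (Fin (n + 1)) (Fin (n + 1)) ℂ => coord l a b) :=
  contDiff_const.mul (contDiff_entry a b)

lemma contDiffAt_quotientMap {l : Matrix (Fin (n + 1)) (Fin (n + 1)) ℂ}
    (hl : ∀ i : Fin n, coord l i.castSucc (Fin.last n) ≠ 0) {k : ℕ∞} :
    ContDiffAt ℝ k quotientMap l := by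
  refine ContDiffAt.prodMk (contDiffAt_pi.2 fun i => ?_) (contDiffAt_pi.2 fun p => ?_)
  · exact (contDiff_coord _ _).contDiffAt.norm ℝ (hl i)
  · exact ((contDiff_coord _ _).contDiffAt.mul
      (Complex.conjCLE.contDiff.contDiffAt.comp l (contDiff_coord _ _).contDiffAt)).mul
      (contDiff_coord _ _).contDiffAt

lemma contDiffAt_hermitianLift {ζ : ShapeVar n} (hζ : ∀ i, ζ.1 i ≠ 0) {k : ℕ∞} :
    ContDiffAt ℝ k hermitianLift ζ := by
  have h1 : ∀ i, ContDiffAt ℝ k (fun w : ShapeVar n => (w.1 i : ℂ)) ζ := fun i =>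
    (Complex.ofRealCLM.contDiff.comp ((contDiff_apply ℝ ℝ i).comp contDiff_fst)).contDiffAt
  have h2 : ∀ p, ContDiffAt ℝ k (fun w : ShapeVar n => w.2 p) ζ := fun p =>
    ((contDiff_apply ℝ ℂ p).comp contDiff_snd).contDiffAt
  have h0 : ∀ i, (ζ.1 i : ℂ) ≠ 0 := fun i => by exact_mod_cast hζ i
  rw [contDiffAt_matrix_iff]
  intro a b
  induction a using Fin.lastCases with
  | last =>
    induction b using Fin.lastCases with
    | last => simpa using contDiffAt_const
    | cast j => simpa using h1 j
  | cast i =>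
    induction b using Fin.lastCases with
    | last => simpa using h1 i
    | cast j =>
      simp only [hermitianLift_castSucc_castSucc]
      split_ifs
      · exact (h2 _).mul (((h1 i).mul (h1 j)).inv (mul_ne_zero (h0 i) (h0 j)))
      · exact (Complex.conjCLE.contDiff.contDiffAt.comp ζ (h2 _)).mul
          (((h1 i).mul (h1 j)).inv (mul_ne_zero (h0 i) (h0 j)))
      · exact contDiffAt_const

lemma contDiffAt_lift {ζ : ShapeVar n} (hζ : ∀ i, ζ.1 i ≠ 0) {k : ℕ∞} :
    ContDiffAt ℝ k lift ζ := by
  rw [contDiffAt_matrix_iff]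
  intro a b
  exact contDiffAt_const.mul (contDiffAt_matrix_iff.1 (contDiffAt_hermitianLift hζ) a b)

lemma coord_lift_ne_zero {ζ : ShapeVar n} (hζ : ∀ i, 0 < ζ.1 i) (i : Fin n) :
    coord (lift ζ) i.castSucc (Fin.last n) ≠ 0 := by
  simpa [coord_lift] using (hζ i).ne'

lemma hasFDerivAt_quotientMap_lift {ζ : ShapeVar n} (hζ : ∀ i, 0 < ζ.1 i) :
    HasFDerivAt quotientMap (fderiv ℝ quotientMap (lift ζ)) (lift ζ) :=
  ((contDiffAt_quotientMap (coord_lift_ne_zero hζ) (k := 1)).differentiableAt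
    one_ne_zero).hasFDerivAt

lemma gradient_comp_quotientMap {F : ShapeVar n → ℝ} {ζ : ShapeVar n} (hζ : ∀ i, 0 < ζ.1 i)
    (hF : DifferentiableAt ℝ F ζ) :
    gradient (F ∘ quotientMap) (lift ζ) =
      dualVector ((fderiv ℝ F ζ) ∘L fderiv ℝ quotientMap (lift ζ)) := by
  refine gradient_eq_dualVector (HasFDerivAt.comp _ ?_ (hasFDerivAt_quotientMap_lift hζ))
  rw [quotientMap_lift hζ]
  exact hF.hasFDerivAt

/-- The Hamiltonian vector field of `G` on the shape space. -/
def hamiltonianField (Γ : Fin (n + 1) → ℝ) (G : ShapeVar n → ℝ) (ζ : ShapeVar n) : ShapeVar n :=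
  fderiv ℝ quotientMap (lift ζ)
    (hamiltonianVector Γ (lift ζ) (gradient (G ∘ quotientMap) (lift ζ)))

lemma gradient_conjTranspose {F : ShapeVar n → ℝ} {ζ : ShapeVar n} (hζ : ∀ i, 0 < ζ.1 i)
    (hF : DifferentiableAt ℝ F ζ) :
    (gradient (F ∘ quotientMap) (lift ζ))ᴴ = -gradient (F ∘ quotientMap) (lift ζ) := by
  rw [gradient_comp_quotientMap hζ hF, dualVector_conjTranspose]

lemma pairing_gradient {F : ShapeVar n → ℝ} {ζ : ShapeVar n} (hζ : ∀ i, 0 < ζ.1 i)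
    (hF : DifferentiableAt ℝ F ζ) {Z : Matrix (Fin (n + 1)) (Fin (n + 1)) ℂ} (hZ : Zᴴ = -Z) :
    pairing (gradient (F ∘ quotientMap) (lift ζ)) Z =
      fderiv ℝ F ζ (fderiv ℝ quotientMap (lift ζ) Z) := by
  rw [gradient_comp_quotientMap hζ hF]
  exact pairing_dualVector ((fderiv ℝ F ζ) ∘L fderiv ℝ quotientMap (lift ζ)).toLinearMap hZ

/-- The skew-Hermitian Hamiltonian vector upstairs is paired with the gradient of `F ∘ quotientMap`;
the chain rule pushes it down to the shape space. -/
lemma shapeBracket_eq_fderiv (Γ : Fin (n + 1) → ℝ) {F G : ShapeVar n → ℝ} {ζ : ShapeVar n}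
    (hζ : ∀ i, 0 < ζ.1 i) (hF : DifferentiableAt ℝ F ζ) (hG : DifferentiableAt ℝ G ζ) :
    shapeBracket Γ F G ζ = fderiv ℝ F ζ (hamiltonianField Γ G ζ) := by
  rw [shapeBracket, liePoisson, neg_pairing_lieBracket Γ (lift_conjTranspose ζ)
    (gradient_conjTranspose hζ hF), pairing_gradient hζ hF (hamiltonianVector_conjTranspose Γ
    (lift_conjTranspose ζ) (gradient_conjTranspose hζ hG)), hamiltonianField]

lemma fderiv_hamiltonianField_self (Γ : Fin (n + 1) → ℝ) {G : ShapeVar n → ℝ} {ζ : ShapeVar n}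
    (hζ : ∀ i, 0 < ζ.1 i) (hG : DifferentiableAt ℝ G ζ) :
    fderiv ℝ G ζ (hamiltonianField Γ G ζ) = 0 := by
  rw [← shapeBracket_eq_fderiv Γ hζ hG hG, shapeBracket, liePoisson, lieBracket, sub_self]
  simp [pairing]

lemma shapeField_eq_hamiltonianField (R : ℝ) (Γ : Fin (n + 1) → ℝ) {ζ : ShapeVar n}
    (hζ : ∀ i, 0 < ζ.1 i) (hH : DifferentiableAt ℝ (shapeHamiltonian R Γ) ζ) :
    shapeField R Γ ζ = hamiltonianField Γ (shapeHamiltonian R Γ) ζ := by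
  -- The real coordinates are continuous linear functionals, each its own derivative, so the
  -- brackets that define `shapeField` are the components of the Hamiltonian field.
  have key : ∀ φ : ShapeVar n →L[ℝ] ℝ, shapeBracket Γ φ (shapeHamiltonian R Γ) ζ =
      φ (hamiltonianField Γ (shapeHamiltonian R Γ) ζ) := fun φ => by
    rw [shapeBracket_eq_fderiv Γ hζ φ.differentiableAt hH, φ.fderiv]
  refine Prod.ext (funext fun i => ?_) (funext fun p => Complex.ext ?_ ?_)
  · exact key ((ContinuousLinearMap.proj i).comp (ContinuousLinearMap.fst ℝ _ _))
  · exact key (Complex.reCLM.comp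
      ((ContinuousLinearMap.proj p).comp (ContinuousLinearMap.snd ℝ _ _)))
  · exact key (Complex.imCLM.comp
      ((ContinuousLinearMap.proj p).comp (ContinuousLinearMap.snd ℝ _ _)))

lemma contDiffAt_hamiltonianField (Γ : Fin (n + 1) → ℝ) {G : ShapeVar n → ℝ} {ζ : ShapeVar n}
    (hζ : ∀ i, 0 < ζ.1 i) (hG : ContDiffAt ℝ 2 G ζ) :
    ContDiffAt ℝ 1 (hamiltonianField Γ G) ζ := by
  have hopen : ∀ᶠ w in 𝓝 ζ, (∀ i, 0 < w.1 i) ∧ DifferentiableAt ℝ G w := by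
    refine Filter.Eventually.and ?_ ?_
    · rw [eventually_all]
      exact fun i => (((continuous_apply i).comp continuous_fst).continuousAt).eventually_const_lt
        (hζ i)
    · exact (hG.eventually (by simp)).mono fun w hw => hw.differentiableAt (by simp)
  have hl : ContDiffAt ℝ 1 lift ζ := contDiffAt_lift (fun i => (hζ i).ne') (k := 1)
  have hQ : ContDiffAt ℝ 1 (fun w => fderiv ℝ quotientMap (lift w)) ζ :=
    ((contDiffAt_quotientMap (coord_lift_ne_zero hζ) (k := 2)).fderiv_right
      (m := 1) (by norm_num)).comp ζ hl
  have hG' : ContDiffAt ℝ 1 (fderiv ℝ G) ζ := hG.fderiv_right (by norm_num)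
  -- `gradient` is built from line derivatives, which carry no regularity by themselves. Smoothness
  -- is read off from the `dualVector` formula, valid on the neighbourhood `hopen`.
  have hη : ContDiffAt ℝ 1 (fun w => gradient (G ∘ quotientMap) (lift w)) ζ := by
    have h1 : ContDiffAt ℝ 1 (fun w => dualVector
        ((fderiv ℝ G w) ∘L fderiv ℝ quotientMap (lift w))) ζ := by
      have hb : ∀ b : Matrix (Fin (n + 1)) (Fin (n + 1)) ℂ, ContDiffAt ℝ 1 (fun w =>
          ((fderiv ℝ G w) ∘L fderiv ℝ quotientMap (lift w)) b • b) ζ := fun b =>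
        (hG'.clm_apply (hQ.clm_apply contDiffAt_const)).smul contDiffAt_const
      refine ContDiffAt.add (ContDiffAt.sum fun i _ => hb _) (ContDiffAt.sum fun i _ =>
        ContDiffAt.sum fun j _ => (hb _).add (hb _))
    refine h1.congr_of_eventuallyEq (hopen.mono fun w hw => ?_)
    exact gradient_comp_quotientMap hw.1 hw.2
  have hY : ContDiffAt ℝ 1 (fun w => hamiltonianVector Γ (lift w)
      (gradient (G ∘ quotientMap) (lift w))) ζ :=
    (ContDiffAt.matrix_mul (ContDiffAt.matrix_mul hl hη) contDiffAt_const).sub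
      (ContDiffAt.matrix_mul (ContDiffAt.matrix_mul contDiffAt_const hη) hl)
  exact hQ.clm_apply hY

end Calculus

/-! ### Casimir functions and their conservation -/

section Casimirs

attribute [local instance] Matrix.normedAddCommGroup Matrix.normedSpace supTopology

lemma hasDerivAt_matrix_iff {f : ℝ → Matrix (Fin (n + 1)) (Fin (n + 1)) ℂ}
    {f' : Matrix (Fin (n + 1)) (Fin (n + 1)) ℂ} {x : ℝ} :
    HasDerivAt f f' x ↔ ∀ a b, HasDerivAt (fun s => f s a b) (f' a b) x :=
  hasDerivAt_pi.trans (forall_congr' fun _ => hasDerivAt_pi)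

lemma HasDerivAt.matrix_mul {f g : ℝ → Matrix (Fin (n + 1)) (Fin (n + 1)) ℂ}
    {f' g' : Matrix (Fin (n + 1)) (Fin (n + 1)) ℂ} {x : ℝ} (hf : HasDerivAt f f' x)
    (hg : HasDerivAt g g' x) : HasDerivAt (fun s => f s * g s) (f' * g x + f x * g') x := by
  rw [hasDerivAt_matrix_iff] at *
  intro a b
  simp only [Matrix.mul_apply, Matrix.add_apply, ← Finset.sum_add_distrib]
  exact HasDerivAt.fun_sum fun c _ => (hf a c).mul (hg c b)

lemma hasDerivAt_line (X Z : Matrix (Fin (n + 1)) (Fin (n + 1)) ℂ) :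
    HasDerivAt (fun s : ℝ => X + s • Z) Z 0 := by
  simpa using ((hasDerivAt_id (0 : ℝ)).smul_const Z).const_add X

/-- Lax form: in the direction of a commutator `[X, W]` the powers of `X` move by `[X ^ k, W]`. -/
lemma hasDerivAt_pow_commutator (X W : Matrix (Fin (n + 1)) (Fin (n + 1)) ℂ) (k : ℕ) :
    HasDerivAt (fun s : ℝ => (X + s • (X * W - W * X)) ^ k) (X ^ k * W - W * X ^ k) 0 := by
  induction k with
  | zero => simpa using hasDerivAt_const (0 : ℝ) (1 : Matrix (Fin (n + 1)) (Fin (n + 1)) ℂ)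
  | succ k ih =>
    have := HasDerivAt.matrix_mul ih (hasDerivAt_line X (X * W - W * X))
    simp only [zero_smul, add_zero] at this
    simp only [pow_succ]
    convert this using 1
    noncomm_ring

/-- The quotient map is constant along the orbits of the torus. -/
lemma fderiv_quotientMap_torus {ζ : ShapeVar n} (hζ : ∀ i, 0 < ζ.1 i) (t : Fin (n + 1) → ℝ) :
    fderiv ℝ quotientMap (lift ζ)
      (Matrix.diagonal (fun a => (t a : ℂ) * Complex.I) * lift ζ -
        lift ζ * Matrix.diagonal (fun a => (t a : ℂ) * Complex.I)) = 0 := by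
  set l := lift ζ with hl
  -- The torus orbit through `l`; its velocity at time zero is the commutator in the statement.
  let c : ℝ → Matrix (Fin (n + 1)) (Fin (n + 1)) ℂ := fun s =>
    Matrix.of fun a b => Complex.exp ((s : ℂ) * (((t a - t b : ℝ) : ℂ) * Complex.I)) * l a b
  have hc0 : c 0 = l := by ext a b; simp [c]
  have hc : HasDerivAt c (Matrix.diagonal (fun a => (t a : ℂ) * Complex.I) * l -
      l * Matrix.diagonal (fun a => (t a : ℂ) * Complex.I)) 0 := by
    rw [hasDerivAt_matrix_iff]
    intro a b
    have h1 : HasDerivAt (fun s : ℝ => (s : ℂ)) 1 0 := Complex.ofRealCLM.hasDerivAt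
    have := ((h1.mul_const (((t a - t b : ℝ) : ℂ) * Complex.I)).cexp).mul_const (l a b)
    have he : (Matrix.diagonal (fun a => (t a : ℂ) * Complex.I) * l -
        l * Matrix.diagonal (fun a => (t a : ℂ) * Complex.I)) a b =
        (t a : ℂ) * Complex.I * l a b - l a b * ((t b : ℂ) * Complex.I) := by
      rw [Matrix.sub_apply, Matrix.diagonal_mul, Matrix.mul_diagonal]
    rw [he]
    refine this.congr_deriv ?_
    simp only [Complex.ofReal_zero, zero_mul, Complex.exp_zero, one_mul, Complex.ofReal_sub]
    ring
  have hnorm : ∀ s x : ℝ, ‖Complex.exp ((s : ℂ) * ((x : ℂ) * Complex.I))‖ = 1 := fun s x => by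
    rw [← mul_assoc, ← Complex.ofReal_mul, Complex.norm_exp_ofReal_mul_I]
  have hQ : ∀ s, quotientMap (c s) = quotientMap l := by
    intro s
    refine Prod.ext (funext fun i => ?_) (funext fun p => ?_)
    · simp only [quotientMap, coord, c, Matrix.of_apply, norm_mul, hnorm, one_mul]
    · have hexp : ∀ a b d : ℝ, Complex.exp ((s : ℂ) * (((a - b : ℝ) : ℂ) * Complex.I)) *
          (starRingEnd ℂ) (Complex.exp ((s : ℂ) * (((a - d : ℝ) : ℂ) * Complex.I))) *
          Complex.exp ((s : ℂ) * (((b - d : ℝ) : ℂ) * Complex.I)) = 1 := by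
        intro a b d
        rw [← Complex.exp_conj, ← Complex.exp_add, ← Complex.exp_add, Complex.exp_eq_one_iff]
        refine ⟨0, ?_⟩
        simp
        ring
      simp only [quotientMap, coord, c, Matrix.of_apply, map_mul]
      have := hexp (t p.1.1.castSucc) (t p.1.2.castSucc) (t (Fin.last n))
      linear_combination (2 * Complex.I * l p.1.1.castSucc p.1.2.castSucc *
        ((starRingEnd ℂ) 2 * (starRingEnd ℂ) Complex.I *
          (starRingEnd ℂ) (l p.1.1.castSucc (Fin.last n))) *
        (2 * Complex.I * l p.1.2.castSucc (Fin.last n))) * this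
  have hf := hasFDerivAt_quotientMap_lift hζ
  rw [← hl, ← hc0] at hf
  have h1 := hf.comp_hasDerivAt (0 : ℝ) hc
  have h2 : quotientMap ∘ c = fun _ => quotientMap l := funext hQ
  rw [h2, hc0] at h1
  exact h1.unique (hasDerivAt_const _ _)

/-- Noether's theorem: `G ∘ quotientMap` is torus invariant, so its flow preserves the momentum map,
the diagonal of `l`. Pairing the gradient with the infinitesimal rotation of the `i`-th phase kills
the imaginary part of the `i`-th diagonal entry of `l * η - η * l`; skew-Hermiticity kills the real
part. -/
lemma hamiltonianVector_diag (Γ : Fin (n + 1) → ℝ) {G : ShapeVar n → ℝ} {ζ : ShapeVar n}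
    (hζ : ∀ i, 0 < ζ.1 i) (hG : DifferentiableAt ℝ G ζ) (i : Fin (n + 1)) :
    hamiltonianVector Γ (lift ζ) (gradient (G ∘ quotientMap) (lift ζ)) i i = 0 := by
  set l := lift ζ with hl
  set η := gradient (G ∘ quotientMap) l with hη
  have hls : lᴴ = -l := lift_conjTranspose ζ
  have hηs : ηᴴ = -η := gradient_conjTranspose hζ hG
  set B := l * η - η * l with hB
  have hBs : Bᴴ = -B := by
    simp only [hB, Matrix.conjTranspose_sub, Matrix.conjTranspose_mul, hls, hηs]
    noncomm_ring
  set E : Matrix (Fin (n + 1)) (Fin (n + 1)) ℂ :=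
    Matrix.diagonal (fun a => ((Pi.single i 1 : Fin (n + 1) → ℝ) a : ℂ) * Complex.I) with hE
  have hEs : Eᴴ = -E := by
    rw [hE, Matrix.diagonal_conjTranspose, Matrix.diagonal_neg]
    congr 1
    ext a
    simp
  have hZ : (E * l - l * E)ᴴ = -(E * l - l * E) := by
    simp only [Matrix.conjTranspose_sub, Matrix.conjTranspose_mul, hls, hEs]
    noncomm_ring
  have h0 : pairing η (E * l - l * E) = 0 := by
    rw [hη, hl, pairing_gradient hζ hG hZ, fderiv_quotientMap_torus hζ, map_zero]
  have htr : (ηᴴ * (E * l - l * E)).trace = -(E * B).trace := by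
    rw [hηs, hB, Matrix.mul_sub, Matrix.mul_sub, Matrix.trace_sub, Matrix.neg_mul, Matrix.neg_mul,
      Matrix.trace_neg, Matrix.trace_neg, Matrix.trace_sub]
    rw [Matrix.trace_mul_comm η (E * l), ← Matrix.mul_assoc η l E, Matrix.trace_mul_comm (η * l) E,
      Matrix.mul_assoc]
    ring
  have htrE : (E * B).trace = Complex.I * B i i := by
    simp [hE, Matrix.trace, Matrix.diagonal_mul, Pi.single_apply, apply_ite, ite_mul]
  have him : (B i i).im = 0 := by
    rw [pairing, htr, htrE] at h0
    simpa using h0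
  have hre : (B i i).re = 0 := by
    have := congrArg Complex.re (congrFun (congrFun hBs i) i)
    simp at this
    linarith
  have hBi : B i i = 0 := Complex.ext hre him
  have : hamiltonianVector Γ l η i i = ((Γ i)⁻¹ : ℂ) * B i i := by
    rw [hamiltonianVector, Matrix.sub_apply, Matrix.mul_diagonal, Matrix.mul_assoc,
      Matrix.diagonal_mul, hB, Matrix.sub_apply]
    ring
  rw [this, hBi, mul_zero]

/-- On the level set of the momentum map, the section of the quotient map conjugates by the torus. -/
lemma hermitianLift_quotientMap {l : Matrix (Fin (n + 1)) (Fin (n + 1)) ℂ} (hl : lᴴ = -l)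
    (hd : ∀ a, l a a = -Complex.I) (h0 : ∀ i : Fin n, coord l i.castSucc (Fin.last n) ≠ 0) :
    ∃ u : Fin (n + 1) → ℂ, (∀ a, u a * star (u a) = 1) ∧
      hermitianLift (quotientMap l) =
        Matrix.diagonal (star u) * ((2 * Complex.I) • l) * Matrix.diagonal u := by
  let c : Fin n → ℂ := fun i => coord l i.castSucc (Fin.last n)
  have hn : ∀ i, (‖c i‖ : ℂ) ≠ 0 := fun i => by exact_mod_cast norm_ne_zero_iff.2 (h0 i)
  have hcc : ∀ i, c i * (starRingEnd ℂ) (c i) = (‖c i‖ : ℂ) ^ 2 := fun i => Complex.mul_conj' _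
  have hsymm : ∀ a b, (starRingEnd ℂ) (coord l a b) = coord l b a := by
    intro a b
    have : (starRingEnd ℂ) (l a b) = -l b a := by
      simpa using congrFun (congrFun hl b) a
    simp only [coord, map_mul, this, Complex.conj_I, map_ofNat]
    ring
  have hdiag : ∀ a, coord l a a = 2 := fun a => by
    rw [coord, hd]; linear_combination (-2) * Complex.I_mul_I
  -- These phases rotate each `λ_{iN}` to its modulus and fix the last vortex.
  refine ⟨Fin.lastCases 1 (fun i => c i / ‖c i‖), fun a => ?_, ?_⟩
  · induction a using Fin.lastCases with
    | last => simp
    | cast i =>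
      simp only [Fin.lastCases_castSucc, star_div₀, Complex.star_def, Complex.conj_ofReal]
      have := hcc i
      have := hn i
      field_simp
      assumption
  · ext a b
    rw [Matrix.mul_diagonal, Matrix.diagonal_mul, Matrix.smul_apply, smul_eq_mul, ← coord.eq_1]
    induction a using Fin.lastCases with
    | last =>
      induction b using Fin.lastCases with
      | last => simp [hdiag]
      | cast j =>
        have h1 := hcc j
        have h2 := hn j
        have h3 : coord l (Fin.last n) j.castSucc = (starRingEnd ℂ) (c j) := (hsymm _ _).symm
        simp only [hermitianLift_last_castSucc, Pi.star_apply, Fin.lastCases_last, star_one,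
          one_mul, Fin.lastCases_castSucc, h3]
        change (‖c j‖ : ℂ) = _
        field_simp
        linear_combination -h1
    | cast i =>
      have h1 := hcc i
      have h2 := hn i
      induction b using Fin.lastCases with
      | last =>
        simp only [hermitianLift_castSucc_last, Pi.star_apply, Fin.lastCases_last, 
          mul_one, Fin.lastCases_castSucc, star_div₀, Complex.star_def, Complex.conj_ofReal]
        change (‖c i‖ : ℂ) = (starRingEnd ℂ) (c i) / ‖c i‖ * c i
        field_simp
        linear_combination -h1
      | cast j =>
        have h1' := hcc j
        have h2' := hn j
        simp only [hermitianLift_castSucc_castSucc, Pi.star_apply, Fin.lastCases_castSucc, star_div₀,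
          Complex.star_def, Complex.conj_ofReal]
        split_ifs with hij hji
        · change coord l i.castSucc j.castSucc * (starRingEnd ℂ) (c i) * c j / (‖c i‖ * ‖c j‖) = _
          field_simp
        · change (starRingEnd ℂ) (coord l j.castSucc i.castSucc * (starRingEnd ℂ) (c j) * c i) /
            (‖c i‖ * ‖c j‖) = _
          rw [map_mul, map_mul, Complex.conj_conj, hsymm]
          field_simp
        · obtain rfl : i = j := le_antisymm (not_lt.1 hji) (not_lt.1 hij)
          rw [hdiag]
          field_simp
          linear_combination -h1

/-- The matrix `D_Γ Λ`, where `Λ` is the Hermitian lift. -/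
def laxMatrix (Γ : Fin (n + 1) → ℝ) (ζ : ShapeVar n) : Matrix (Fin (n + 1)) (Fin (n + 1)) ℂ :=
  Matrix.diagonal (fun a => (Γ a : ℂ)) * hermitianLift ζ

/-- The Casimir functions `tr ((D_Γ Λ) ^ k)`. -/
def casimir (Γ : Fin (n + 1) → ℝ) (k : ℕ) (ζ : ShapeVar n) : ℝ :=
  (laxMatrix Γ ζ ^ k).trace.re

lemma conj_pow_of_mul_eq_one {A : Type*} [Monoid A] {U V : A} (h : U * V = 1) (h' : V * U = 1)
    (X : A) (k : ℕ) :
    (V * X * U) ^ k = V * X ^ k * U := by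
  induction k with
  | zero => simp [h']
  | succ k ih =>
    rw [pow_succ, ih, pow_succ]
    calc V * X ^ k * U * (V * X * U) = V * X ^ k * (U * V) * X * U := by simp only [mul_assoc]
      _ = _ := by rw [h, mul_one]; simp only [mul_assoc]

/-- The torus commutes with `D_Γ`, so passing from `l` to the lift of its shape conjugates the Lax
matrix and keeps the traces of its powers. -/
lemma casimir_quotientMap (Γ : Fin (n + 1) → ℝ) (k : ℕ)
    {l : Matrix (Fin (n + 1)) (Fin (n + 1)) ℂ} (hl : lᴴ = -l)
    (hd : ∀ a, l a a = -Complex.I) (h0 : ∀ i : Fin n, coord l i.castSucc (Fin.last n) ≠ 0) :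
    casimir Γ k (quotientMap l) =
      ((Matrix.diagonal (fun a => (Γ a : ℂ)) * ((2 * Complex.I) • l)) ^ k).trace.re := by
  obtain ⟨u, hu, hL⟩ := hermitianLift_quotientMap hl hd h0
  have h1 : Matrix.diagonal u * Matrix.diagonal (star u) = 1 := by
    rw [Matrix.diagonal_mul_diagonal, ← Matrix.diagonal_one]
    exact congrArg _ (funext hu)
  have h2 : Matrix.diagonal (star u) * Matrix.diagonal u = 1 := by
    rw [Matrix.diagonal_mul_diagonal, ← Matrix.diagonal_one]
    exact congrArg _ (funext fun a => (mul_comm _ _).trans (hu a))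
  have h3 : laxMatrix Γ (quotientMap l) = Matrix.diagonal (star u) *
      (Matrix.diagonal (fun a => (Γ a : ℂ)) * ((2 * Complex.I) • l)) * Matrix.diagonal u := by
    rw [laxMatrix, hL]
    simp only [← Matrix.mul_assoc, Matrix.diagonal_mul_diagonal, mul_comm]
  rw [casimir, h3, conj_pow_of_mul_eq_one h1 h2, Matrix.trace_mul_comm, ← Matrix.mul_assoc, h1,
    Matrix.one_mul]

lemma differentiableAt_casimir (Γ : Fin (n + 1) → ℝ) (k : ℕ) {ζ : ShapeVar n}
    (hζ : ∀ i, ζ.1 i ≠ 0) : DifferentiableAt ℝ (casimir Γ k) ζ := by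
  have h1 : ContDiffAt ℝ 1 (laxMatrix Γ) ζ :=
    ContDiffAt.matrix_mul contDiffAt_const (contDiffAt_hermitianLift hζ (k := 1))
  have h2 : ContDiffAt ℝ 1 (fun w => laxMatrix Γ w ^ k) ζ := by
    induction k with
    | zero => simpa using contDiffAt_const
    | succ k ih => simpa only [pow_succ] using ContDiffAt.matrix_mul ih h1
  have h3 : ContDiffAt ℝ 1 (casimir Γ k) ζ :=
    Complex.reCLM.contDiff.contDiffAt.comp ζ
      (ContDiffAt.sum fun a _ => contDiffAt_matrix_iff.1 h2 a a)
  exact h3.differentiableAt one_ne_zero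

/-- The Casimir functions are conserved by every Hamiltonian vector field. -/
theorem fderiv_casimir_hamiltonianField {Γ : Fin (n + 1) → ℝ} (hΓ : ∀ a, Γ a ≠ 0) (k : ℕ)
    {G : ShapeVar n → ℝ} {ζ : ShapeVar n} (hζ : ∀ i, 0 < ζ.1 i) (hG : DifferentiableAt ℝ G ζ) :
    fderiv ℝ (casimir Γ k) ζ (hamiltonianField Γ G ζ) = 0 := by
  set l := lift ζ with hl
  set η := gradient (G ∘ quotientMap) l with hη
  set Y := hamiltonianVector Γ l η with hY
  have hls : lᴴ = -l := lift_conjTranspose ζ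
  have hYs : Yᴴ = -Y := hamiltonianVector_conjTranspose Γ hls (gradient_conjTranspose hζ hG)
  set D := Matrix.diagonal (fun a => (Γ a : ℂ)) with hD
  set D' := Matrix.diagonal (fun i => ((Γ i)⁻¹ : ℂ)) with hD'
  have hDD' : D * D' = 1 := by
    rw [hD, hD', Matrix.diagonal_mul_diagonal, ← Matrix.diagonal_one]
    congr 1
    ext a
    exact mul_inv_cancel₀ (by exact_mod_cast hΓ a)
  have hD'D : D' * D = 1 := mul_eq_one_comm.1 hDD'
  set X := D * ((2 * Complex.I) • l) with hX
  -- The Lax form of the equation of motion: the velocity of `X = D_Γ (2 i l)` is a commutator with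
  -- `X`, so traces of powers have zero derivative.
  have hcomm : D * ((2 * Complex.I) • Y) = X * (η * D') - (η * D') * X := by
    have e1 : D * Y = D * l * η * D' - η * l := by
      rw [hY, hamiltonianVector, Matrix.mul_sub, ← hD', ← Matrix.mul_assoc, ← Matrix.mul_assoc,
        ← Matrix.mul_assoc, ← Matrix.mul_assoc, hDD', Matrix.one_mul]
    have e2 : η * D' * (D * l) = η * l := by
      rw [Matrix.mul_assoc, ← Matrix.mul_assoc D', hD'D, Matrix.one_mul]
    rw [hX, Matrix.mul_smul, Matrix.mul_smul, e1, Matrix.mul_smul, Matrix.smul_mul, e2,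
      ← smul_sub, Matrix.mul_assoc (D * l)]
  have hline : HasDerivAt (fun s : ℝ => l + s • Y) Y 0 := hasDerivAt_line l Y
  -- The whole line `l + s • Y` lies in the level set of the momentum map, since `Y` has zero
  -- diagonal. Only there is the Casimir of the shape a trace of powers upstairs.
  have hdiag : ∀ (s : ℝ) a, (l + s • Y) a a = -Complex.I := by
    intro s a
    have : Y a a = 0 := hamiltonianVector_diag Γ hζ hG a
    rw [Matrix.add_apply, Matrix.smul_apply, this, smul_zero, add_zero, hl, lift,
      Matrix.smul_apply, hermitianLift_diag, smul_eq_mul]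
    ring
  have hskew : ∀ s : ℝ, (l + s • Y)ᴴ = -(l + s • Y) := by
    intro s
    rw [Matrix.conjTranspose_add, Matrix.conjTranspose_smul, hls, hYs]
    simp
    abel
  have hne : ∀ᶠ s : ℝ in 𝓝 0, ∀ i : Fin n, coord (l + s • Y) i.castSucc (Fin.last n) ≠ 0 := by
    rw [eventually_all]
    intro i
    have hc : ContinuousAt (fun s : ℝ => coord (l + s • Y) i.castSucc (Fin.last n)) 0 :=
      (contDiff_coord (k := 0) _ _).continuous.continuousAt.comp_of_eq hline.continuousAt rfl
    refine hc.eventually_ne ?_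
    simpa using coord_lift_ne_zero hζ i
  have hcas : HasDerivAt (fun s : ℝ => casimir Γ k (quotientMap (l + s • Y)))
      (fderiv ℝ (casimir Γ k) ζ (hamiltonianField Γ G ζ)) 0 := by
    have hC := (differentiableAt_casimir Γ k (fun i => (hζ i).ne')).hasFDerivAt
    have h1 : HasFDerivAt (casimir Γ k) (fderiv ℝ (casimir Γ k) ζ) (quotientMap l) := by
      rw [hl, quotientMap_lift hζ]; exact hC
    have h2 := h1.comp l (hasFDerivAt_quotientMap_lift hζ)
    have h3 : HasFDerivAt (casimir Γ k ∘ quotientMap) ((fderiv ℝ (casimir Γ k) ζ).comp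
      (fderiv ℝ quotientMap (lift ζ))) (l + (0 : ℝ) • Y) := by simpa using h2
    exact h3.comp_hasDerivAt (0 : ℝ) hline
  have hpow := hasDerivAt_matrix_iff.1 (hasDerivAt_pow_commutator X (η * D') k)
  have htr : HasDerivAt (fun s : ℝ => ((X + s • (X * (η * D') - (η * D') * X)) ^ k).trace.re)
      ((X ^ k * (η * D') - (η * D') * X ^ k).trace.re) 0 :=
    Complex.reCLM.hasFDerivAt.comp_hasDerivAt (0 : ℝ)
      (HasDerivAt.fun_sum fun a _ => hpow a a)
  rw [Matrix.trace_sub, Matrix.trace_mul_comm, sub_self, Complex.zero_re] at htr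
  refine hcas.unique (htr.congr_of_eventuallyEq (hne.mono fun s hs => ?_))
  beta_reduce
  rw [casimir_quotientMap Γ k (hskew s) (hdiag s) hs, ← hcomm, smul_add, Matrix.mul_add, ← hD,
    smul_comm _ s Y, Matrix.mul_smul D s]

end Casimirs

open scoped ComplexOrder

/-! ### A cubic that detects Hermitian matrices of rank two -/

/-- The matrix `M ^ 3 - p M ^ 2 + q M`. -/
def cubic {ι : Type*} [Fintype ι] [DecidableEq ι] (p q : ℝ) (M : Matrix ι ι ℂ) : Matrix ι ι ℂ :=
  M ^ 3 - (p : ℂ) • M ^ 2 + (q : ℂ) • M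

lemma trace_mul_self_of_isHermitian_nonneg {ι : Type*} [Fintype ι] {B : Matrix ι ι ℂ} (hB : B.IsHermitian) :
    0 ≤ (B * B).trace.re := by
  have := (Matrix.posSemidef_conjTranspose_mul_self B).trace_nonneg
  rw [hB.eq] at this
  exact (Complex.le_def.1 this).1

lemma eq_zero_of_trace_mul_self_re_eq_zero {ι : Type*} [Fintype ι]
    {B : Matrix ι ι ℂ} (hB : B.IsHermitian)
    (h : (B * B).trace.re = 0) : B = 0 := by
  have hnn := (Matrix.posSemidef_conjTranspose_mul_self B).trace_nonneg
  have h0 : (Bᴴ * B).trace = 0 := by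
    have him := (Complex.le_def.1 hnn).2
    refine Complex.ext ?_ him.symm
    rw [hB.eq]; exact h
  exact Matrix.trace_conjTranspose_mul_self_eq_zero_iff.1 h0

section Cubic

variable {ι : Type*} [Fintype ι] [DecidableEq ι]

/-- Presents the penalty term as a combination of the Casimirs of degrees two to six, hence as a
conserved quantity. -/
lemma trace_cubic_sq (p q : ℝ) (M : Matrix ι ι ℂ) :
    (cubic p q M * cubic p q M).trace = (M ^ 6).trace - 2 * p * (M ^ 5).trace +
      (p ^ 2 + 2 * q) * (M ^ 4).trace - 2 * p * q * (M ^ 3).trace + q ^ 2 * (M ^ 2).trace := by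
  have h : cubic p q M * cubic p q M = M ^ 6 - (2 * p : ℂ) • M ^ 5 +
      (p ^ 2 + 2 * q : ℂ) • M ^ 4 - (2 * p * q : ℂ) • M ^ 3 + (q ^ 2 : ℂ) • M ^ 2 := by
    have h33 : M ^ 3 * M ^ 3 = M ^ 6 := (pow_add M 3 3).symm
    have h32 : M ^ 3 * M ^ 2 = M ^ 5 := (pow_add M 3 2).symm
    have h23 : M ^ 2 * M ^ 3 = M ^ 5 := (pow_add M 2 3).symm
    have h22 : M ^ 2 * M ^ 2 = M ^ 4 := (pow_add M 2 2).symm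
    have h31 : M ^ 3 * M = M ^ 4 := (pow_succ M 3).symm
    have h13 : M * M ^ 3 = M ^ 4 := (pow_succ' M 3).symm
    have h21 : M ^ 2 * M = M ^ 3 := (pow_succ M 2).symm
    have h12 : M * M ^ 2 = M ^ 3 := (pow_succ' M 2).symm
    have h11 : M * M = M ^ 2 := (pow_two M).symm
    simp only [cubic, Matrix.mul_add, Matrix.add_mul, Matrix.mul_sub, Matrix.sub_mul,
      Matrix.smul_mul, Matrix.mul_smul, h33, h32, h23, h22, h31, h13, h21, h12, h11]
    module
  rw [h]
  simp only [Matrix.trace_add, Matrix.trace_sub, Matrix.trace_smul, smul_eq_mul]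

lemma cubic_isHermitian (p q : ℝ) {A : Matrix ι ι ℂ} (hA : A.IsHermitian) :
    (cubic p q A).IsHermitian := by
  have hs : ∀ c : ℝ, IsSelfAdjoint (c : ℂ) := fun c => Complex.conj_ofReal c
  exact ((hA.pow 3).sub ((hA.pow 2).smul (hs p))).add (hA.smul (hs q))

/-- A Hermitian zero of the cubic with positive coefficients is positive semidefinite. -/
lemma posSemidef_of_cubic_eq_zero {p q : ℝ} (hp : 0 < p) (hq : 0 < q) {A : Matrix ι ι ℂ}
    (hA : A.IsHermitian) (h : cubic p q A = 0) : A.PosSemidef := by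
  rw [hA.posSemidef_iff_eigenvalues_nonneg]
  intro i
  set t := hA.eigenvalues i with ht
  have hv : A *ᵥ ⇑(hA.eigenvectorBasis i) = (t : ℂ) • ⇑(hA.eigenvectorBasis i) := by
    simpa using hA.mulVec_eigenvectorBasis i
  set v : ι → ℂ := ⇑(hA.eigenvectorBasis i) with hvdef
  have hv0 : v ≠ 0 := by
    intro h0
    apply hA.eigenvectorBasis.orthonormal.ne_zero i
    ext a
    exact congrFun h0 a
  have h2 : (A ^ 2) *ᵥ v = ((t : ℂ) ^ 2) • v := by
    rw [pow_two, ← Matrix.mulVec_mulVec, hv, Matrix.mulVec_smul, hv, smul_smul, pow_two]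
  have h3 : (A ^ 3) *ᵥ v = ((t : ℂ) ^ 3) • v := by
    rw [pow_succ, ← Matrix.mulVec_mulVec, hv, Matrix.mulVec_smul, h2, smul_smul,
      ← pow_succ']
  have h4 : ((t : ℂ) ^ 3 - p * t ^ 2 + q * t) • v = 0 := by
    have := congrArg (· *ᵥ v) h
    simp only [cubic, Matrix.add_mulVec, Matrix.sub_mulVec, Matrix.smul_mulVec, hv, h2, h3,
      Matrix.zero_mulVec, smul_smul] at this
    rw [add_smul, sub_smul, this]
  have h5 : t ^ 3 - p * t ^ 2 + q * t = 0 := by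
    exact_mod_cast (smul_eq_zero.1 h4).resolve_right hv0
  change 0 ≤ t
  -- At a negative `t` the three terms `t ^ 2`, `-p * t` and `q` are all positive.
  by_contra! hneg
  have h6 : t ^ 2 - p * t + q = 0 := by
    apply mul_left_cancel₀ hneg.ne
    linear_combination h5
  nlinarith [mul_pos hp (neg_pos.2 hneg), sq_nonneg t]

/-- The positive square root of `D_Γ`, and the similarity of `D_Γ L` to a Hermitian matrix. -/
lemma exists_similar_hermitian {Γ : ι → ℝ} (hΓ : ∀ a, 0 < Γ a) {L : Matrix ι ι ℂ}
    (hL : L.IsHermitian) :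
    ∃ S T : Matrix ι ι ℂ, S * T = 1 ∧ T * S = 1 ∧ Tᴴ = T ∧ (S * L * S).IsHermitian ∧
      Matrix.diagonal (fun a => (Γ a : ℂ)) * L = S * (S * L * S) * T := by
  let S : Matrix ι ι ℂ := Matrix.diagonal fun a => ((√(Γ a) : ℝ) : ℂ)
  let T : Matrix ι ι ℂ := Matrix.diagonal fun a => (((√(Γ a))⁻¹ : ℝ) : ℂ)
  have hST : S * T = 1 := by
    rw [Matrix.diagonal_mul_diagonal, ← Matrix.diagonal_one]
    congr 1
    ext a
    rw [← Complex.ofReal_mul, mul_inv_cancel₀ (Real.sqrt_pos.2 (hΓ a)).ne', Complex.ofReal_one]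
  have hherm : ∀ f : ι → ℝ, (Matrix.diagonal fun a => (f a : ℂ))ᴴ = Matrix.diagonal fun a => (f a : ℂ) :=
    fun f => by
      rw [Matrix.diagonal_conjTranspose]
      congr 1
      ext a
      simp
  have hSS : S * S = Matrix.diagonal (fun a => (Γ a : ℂ)) := by
    rw [Matrix.diagonal_mul_diagonal]
    congr 1
    ext a
    rw [← Complex.ofReal_mul, Real.mul_self_sqrt (hΓ a).le]
  refine ⟨S, T, hST, mul_eq_one_comm.1 hST, hherm _, ?_, ?_⟩
  · rw [Matrix.IsHermitian, Matrix.conjTranspose_mul, Matrix.conjTranspose_mul, hherm, hL.eq,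
      Matrix.mul_assoc]
  · simp only [Matrix.mul_assoc, hST, Matrix.mul_one]
    rw [← Matrix.mul_assoc, hSS]

lemma cubic_conj (p q : ℝ) {S T : Matrix ι ι ℂ} (hTS : T * S = 1) (hST : S * T = 1)
    (A : Matrix ι ι ℂ) : cubic p q (S * A * T) = S * cubic p q A * T := by
  simp only [cubic, conj_pow_of_mul_eq_one hTS hST, Matrix.mul_add, Matrix.add_mul, Matrix.mul_sub,
    Matrix.sub_mul, Matrix.mul_smul, Matrix.smul_mul]

lemma trace_cubic_sq_conj (p q : ℝ) {S T : Matrix ι ι ℂ} (hTS : T * S = 1) (hST : S * T = 1)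
    (A : Matrix ι ι ℂ) :
    (cubic p q (S * A * T) * cubic p q (S * A * T)).trace =
      (cubic p q A * cubic p q A).trace := by
  rw [cubic_conj p q hTS hST]
  have : S * cubic p q A * T * (S * cubic p q A * T) = S * (cubic p q A * cubic p q A) * T := by
    calc _ = S * cubic p q A * (T * S) * cubic p q A * T := by simp only [Matrix.mul_assoc]
      _ = _ := by rw [hTS, Matrix.mul_one]; simp only [Matrix.mul_assoc]
  rw [this, Matrix.trace_mul_comm, ← Matrix.mul_assoc, hTS, Matrix.one_mul]

/-- After conjugation to the Hermitian matrix `S * L * S` this is the trace of the square of a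
Hermitian matrix. Positive circulations are needed for the square root of `D_Γ`. -/
lemma trace_cubic_sq_nonneg (p q : ℝ) {Γ : ι → ℝ} (hΓ : ∀ a, 0 < Γ a) {L : Matrix ι ι ℂ}
    (hL : L.IsHermitian) :
    0 ≤ (cubic p q (Matrix.diagonal (fun a => (Γ a : ℂ)) * L) *
      cubic p q (Matrix.diagonal (fun a => (Γ a : ℂ)) * L)).trace.re := by
  obtain ⟨S, T, hST, hTS, -, hA, hL'⟩ := exists_similar_hermitian hΓ hL
  rw [hL', trace_cubic_sq_conj p q hTS hST]
  exact trace_mul_self_of_isHermitian_nonneg (cubic_isHermitian p q hA)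

/-- The squared Frobenius norm vanishes, so the cubic annihilates `S * L * S`, whose eigenvalues are
then nonnegative; congruence by `T` carries this back to `L`. -/
lemma posSemidef_of_trace_cubic_sq_eq_zero {p q : ℝ} (hp : 0 < p) (hq : 0 < q) {Γ : ι → ℝ}
    (hΓ : ∀ a, 0 < Γ a) {L : Matrix ι ι ℂ} (hL : L.IsHermitian)
    (h : (cubic p q (Matrix.diagonal (fun a => (Γ a : ℂ)) * L) *
      cubic p q (Matrix.diagonal (fun a => (Γ a : ℂ)) * L)).trace.re = 0) :
    L.PosSemidef ∧ cubic p q (Matrix.diagonal (fun a => (Γ a : ℂ)) * L) = 0 := by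
  obtain ⟨S, T, hST, hTS, hT, hA, hL'⟩ := exists_similar_hermitian hΓ hL
  rw [hL', trace_cubic_sq_conj p q hTS hST] at h
  have h0 := eq_zero_of_trace_mul_self_re_eq_zero (cubic_isHermitian p q hA) h
  constructor
  · have h1 := (posSemidef_of_cubic_eq_zero hp hq hA h0).mul_mul_conjTranspose_same T
    have h2 : T * (S * L * S) * Tᴴ = L := by
      rw [hT]
      calc _ = (T * S) * L * (S * T) := by simp only [Matrix.mul_assoc]
        _ = L := by rw [hTS, hST, Matrix.one_mul, Matrix.mul_one]
    rwa [h2] at h1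
  · rw [hL', cubic_conj p q hTS hST, h0, Matrix.mul_zero, Matrix.zero_mul]

end Cubic

/-! ### Four by four matrices -/

lemma trace_four (g : Fin 4 → ℂ) (L : Matrix (Fin 4) (Fin 4) ℂ) :
    (Matrix.diagonal g * L).trace = g 0 * L 0 0 + g 1 * L 1 1 + g 2 * L 2 2 + g 3 * L 3 3 := by
  simp [Matrix.trace, Matrix.diagonal_mul, Fin.sum_univ_four]

lemma trace_sq_four (g : Fin 4 → ℂ) (L : Matrix (Fin 4) (Fin 4) ℂ) :
    ((Matrix.diagonal g * L) ^ 2).trace =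
      g 0 ^ 2 * L 0 0 ^ 2 + g 1 ^ 2 * L 1 1 ^ 2 + g 2 ^ 2 * L 2 2 ^ 2 + g 3 ^ 2 * L 3 3 ^ 2 +
      2 * (g 0 * g 1 * (L 0 1 * L 1 0) + g 0 * g 2 * (L 0 2 * L 2 0) + g 1 * g 2 * (L 1 2 * L 2 1) +
        g 0 * g 3 * (L 0 3 * L 3 0) + g 1 * g 3 * (L 1 3 * L 3 1) + g 2 * g 3 * (L 2 3 * L 3 2)) := by
  simp only [pow_two, Matrix.trace, Matrix.diag_apply, Matrix.mul_apply (M := Matrix.diagonal g * L),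
    Matrix.diagonal_mul, Fin.sum_univ_four]
  ring

lemma trace_cube_four (g : Fin 4 → ℂ) (L : Matrix (Fin 4) (Fin 4) ℂ) (hd : ∀ a, L a a = 2) :
    ((Matrix.diagonal g * L) ^ 3).trace =
      8 * (g 0 ^ 3 + g 1 ^ 3 + g 2 ^ 3 + g 3 ^ 3) +
      6 * (g 0 * g 1 * (g 0 + g 1) * (L 0 1 * L 1 0) + g 0 * g 2 * (g 0 + g 2) * (L 0 2 * L 2 0) +
        g 1 * g 2 * (g 1 + g 2) * (L 1 2 * L 2 1) + g 0 * g 3 * (g 0 + g 3) * (L 0 3 * L 3 0) +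
        g 1 * g 3 * (g 1 + g 3) * (L 1 3 * L 3 1) + g 2 * g 3 * (g 2 + g 3) * (L 2 3 * L 3 2)) +
      3 * (g 0 * g 1 * g 2 * (L 0 1 * L 1 2 * L 2 0 + L 0 2 * L 2 1 * L 1 0) +
        g 0 * g 1 * g 3 * (L 0 1 * L 1 3 * L 3 0 + L 0 3 * L 3 1 * L 1 0) +
        g 0 * g 2 * g 3 * (L 0 2 * L 2 3 * L 3 0 + L 0 3 * L 3 2 * L 2 0) +
        g 1 * g 2 * g 3 * (L 1 2 * L 2 3 * L 3 1 + L 1 3 * L 3 2 * L 2 1)) := by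
  simp only [pow_succ, pow_zero, one_mul, Matrix.trace, Matrix.diag_apply,
    Matrix.mul_apply (M := Matrix.diagonal g * L),
    Matrix.mul_apply (M := Matrix.diagonal g * L * (Matrix.diagonal g * L)),
    Matrix.diagonal_mul, Fin.sum_univ_four, hd]
  ring

/-- The sum of the products of the pairs of the four circulations. -/
def pairSum (Γ : Fin 4 → ℝ) : ℝ :=
  Γ 0 * Γ 1 + Γ 0 * Γ 2 + Γ 1 * Γ 2 + Γ 0 * Γ 3 + Γ 1 * Γ 3 + Γ 2 * Γ 3

/-- The coefficients of the characteristic polynomial `t ^ 2 (t ^ 2 - p t + q)` of `D_Γ Λ` at the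
tetrahedron. -/
def coeffP (Γ : Fin 4 → ℝ) : ℝ := 2 * (Γ 0 + Γ 1 + Γ 2 + Γ 3)

/-- See `coeffP`. -/
def coeffQ (Γ : Fin 4 → ℝ) : ℝ := 8 / 3 * pairSum Γ

/-- The principal minor on `a, b, c` is `8 - 3 · 2 · (4 / 3)` plus twice this real part, and the
constants cancel. -/
lemma triple_re_nonneg {L : Matrix (Fin 4) (Fin 4) ℂ} (hL : L.PosSemidef) (hd : ∀ a, L a a = 2)
    (hs : ∀ a b, a ≠ b → L a b * L b a = 4 / 3) {a b c : Fin 4} (hab : a ≠ b) (hac : a ≠ c)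
    (hbc : b ≠ c) : 0 ≤ (L a b * L b c * L c a).re := by
  have hdet := (hL.submatrix ![a, b, c]).det_nonneg
  have hconj : L a c * L c b * L b a = (starRingEnd ℂ) (L a b * L b c * L c a) := by
    have h : ∀ i j, (starRingEnd ℂ) (L i j) = L j i := fun i j => hL.isHermitian.apply j i
    rw [map_mul, map_mul, h, h, h]
    ring
  have hre : (L.submatrix ![a, b, c] ![a, b, c]).det =
      L a b * L b c * L c a + (starRingEnd ℂ) (L a b * L b c * L c a) := by
    rw [Matrix.det_fin_three, ← hconj]
    simp [hd]
    linear_combination (-2) * hs a b hab - 2 * hs a c hac - 2 * hs b c hbc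
  rw [hre, Complex.add_conj] at hdet
  have := (Complex.le_def.1 hdet).1
  rw [Complex.ofReal_re, Complex.zero_re] at this
  linarith

/-- If all off-diagonal moduli are those of the tetrahedron and the cubic vanishes, then the real
parts of all products along triangles vanish. -/
lemma triple_re_eq_zero {Γ : Fin 4 → ℝ} (hΓ : ∀ a, 0 < Γ a) {L : Matrix (Fin 4) (Fin 4) ℂ}
    (hL : L.IsHermitian) (hd : ∀ a, L a a = 2) (hs : ∀ a b, a ≠ b → L a b * L b a = 4 / 3)
    (h : (cubic (coeffP Γ) (coeffQ Γ) (Matrix.diagonal (fun a => (Γ a : ℂ)) * L) *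
      cubic (coeffP Γ) (coeffQ Γ) (Matrix.diagonal (fun a => (Γ a : ℂ)) * L)).trace.re = 0) :
    (L 0 1 * L 1 3 * L 3 0).re = 0 ∧ (L 0 2 * L 2 3 * L 3 0).re = 0 ∧
      (L 1 2 * L 2 3 * L 3 1).re = 0 := by
  have h0 := hΓ 0
  have h1 := hΓ 1
  have h2 := hΓ 2
  have h3 := hΓ 3
  obtain ⟨hpsd, hc⟩ := posSemidef_of_trace_cubic_sq_eq_zero
    (by unfold coeffP; positivity) (by unfold coeffQ pairSum; positivity) hΓ hL h
  have hconj : ∀ a b c, L a c * L c b * L b a = (starRingEnd ℂ) (L a b * L b c * L c a) := by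
    intro a b c
    have h : ∀ i j, (starRingEnd ℂ) (L i j) = L j i := fun i j => hL.apply j i
    rw [map_mul, map_mul, h, h, h]
    ring
  have htr := congrArg Matrix.trace hc
  rw [cubic, Matrix.trace_add, Matrix.trace_sub, Matrix.trace_smul, Matrix.trace_smul,
    trace_four, trace_sq_four, trace_cube_four _ _ hd, Matrix.trace_zero] at htr
  simp only [hd, hs _ _ (show (0 : Fin 4) ≠ 1 by decide), hs _ _ (show (0 : Fin 4) ≠ 2 by decide),
    hs _ _ (show (0 : Fin 4) ≠ 3 by decide), hs _ _ (show (1 : Fin 4) ≠ 2 by decide),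
    hs _ _ (show (1 : Fin 4) ≠ 3 by decide), hs _ _ (show (2 : Fin 4) ≠ 3 by decide), hconj 0 1 2,
    hconj 0 1 3, hconj 0 2 3, hconj 1 2 3,
    Complex.add_conj, coeffP, coeffQ, pairSum, smul_eq_mul] at htr
  have n1 := triple_re_nonneg hpsd hd hs (show (0 : Fin 4) ≠ 1 by decide)
    (show (0 : Fin 4) ≠ 2 by decide) (show (1 : Fin 4) ≠ 2 by decide)
  have n2 := triple_re_nonneg hpsd hd hs (show (0 : Fin 4) ≠ 1 by decide)
    (show (0 : Fin 4) ≠ 3 by decide) (show (1 : Fin 4) ≠ 3 by decide)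
  have n3 := triple_re_nonneg hpsd hd hs (show (0 : Fin 4) ≠ 2 by decide)
    (show (0 : Fin 4) ≠ 3 by decide) (show (2 : Fin 4) ≠ 3 by decide)
  have n4 := triple_re_nonneg hpsd hd hs (show (1 : Fin 4) ≠ 2 by decide)
    (show (1 : Fin 4) ≠ 3 by decide) (show (2 : Fin 4) ≠ 3 by decide)
  -- In the trace of the cubic, `p` and `q` cancel everything that depends only on the moduli. What
  -- remains is six times this sum, all of whose terms are nonnegative by `n1` to `n4`.
  have key : Γ 0 * Γ 1 * Γ 2 * (L 0 1 * L 1 2 * L 2 0).re +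
      Γ 0 * Γ 1 * Γ 3 * (L 0 1 * L 1 3 * L 3 0).re +
      Γ 0 * Γ 2 * Γ 3 * (L 0 2 * L 2 3 * L 3 0).re +
      Γ 1 * Γ 2 * Γ 3 * (L 1 2 * L 2 3 * L 3 1).re = 0 := by
    generalize (L 0 1 * L 1 2 * L 2 0).re = a at *
    generalize (L 0 1 * L 1 3 * L 3 0).re = b at *
    generalize (L 0 2 * L 2 3 * L 3 0).re = c at *
    generalize (L 1 2 * L 2 3 * L 3 1).re = d at *
    have hC : ((Γ 0 * Γ 1 * Γ 2 * a + Γ 0 * Γ 1 * Γ 3 * b + Γ 0 * Γ 2 * Γ 3 * c +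
        Γ 1 * Γ 2 * Γ 3 * d : ℝ) : ℂ) = 0 := by
      push_cast at htr ⊢
      linear_combination htr / 6
    exact_mod_cast hC
  have m1 := mul_nonneg (mul_pos (mul_pos h0 h1) h2).le n1
  have m2 := mul_nonneg (mul_pos (mul_pos h0 h1) h3).le n2
  have m3 := mul_nonneg (mul_pos (mul_pos h0 h2) h3).le n3
  have m4 := mul_nonneg (mul_pos (mul_pos h1 h2) h3).le n4
  refine ⟨?_, ?_, ?_⟩
  · exact (mul_eq_zero.1 (by linarith : Γ 0 * Γ 1 * Γ 3 * _ = 0)).resolve_left (by positivity)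
  · exact (mul_eq_zero.1 (by linarith : Γ 0 * Γ 2 * Γ 3 * _ = 0)).resolve_left (by positivity)
  · exact (mul_eq_zero.1 (by linarith : Γ 1 * Γ 2 * Γ 3 * _ = 0)).resolve_left (by positivity)

lemma cubic_entry (g : Fin 4 → ℂ) (L : Matrix (Fin 4) (Fin 4) ℂ) (p q : ℂ) (i j : Fin 4) :
    (L * Matrix.diagonal g * (L * Matrix.diagonal g) * L - p • (L * Matrix.diagonal g * L) +
      q • L) i j = ∑ m, (∑ k, L i k * g k * (L k m * g m)) * L m j -
      p * ∑ k, L i k * g k * L k j + q * L i j := by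
  simp only [Matrix.add_apply, Matrix.sub_apply, Matrix.smul_apply, smul_eq_mul,
    Matrix.mul_apply (M := L * Matrix.diagonal g * (L * Matrix.diagonal g)),
    Matrix.mul_apply (M := L * Matrix.diagonal g), Matrix.mul_diagonal]

/-- The Hermitian matrix of a tetrahedron has rank two, which is detected by the cubic. -/
lemma cubic_tetrahedron (Γ : Fin 4 → ℝ) {b c : ℂ} (hb : b ^ 2 = -4 / 3) (hc : c ^ 2 = 4 / 3) :
    cubic (coeffP Γ) (coeffQ Γ) (Matrix.diagonal (fun a => (Γ a : ℂ)) *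
      !![2, b, -b, c; -b, 2, b, c; b, -b, 2, c; c, c, c, 2]) = 0 := by
  set D := Matrix.diagonal (fun a => (Γ a : ℂ)) with hD
  set L : Matrix (Fin 4) (Fin 4) ℂ := !![2, b, -b, c; -b, 2, b, c; b, -b, 2, c; c, c, c, 2] with hL
  -- Pulling the left factor `D` out leaves an identity to be checked entry by entry, of lower
  -- degree in the circulations.
  have h : cubic (coeffP Γ) (coeffQ Γ) (D * L) =
      D * ((L * D) * (L * D) * L - (coeffP Γ : ℂ) • (L * D * L) + (coeffQ Γ : ℂ) • L) := by
    simp only [cubic, pow_succ, pow_zero, one_mul, Matrix.mul_add, Matrix.mul_sub, Matrix.mul_smul,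
      Matrix.mul_assoc]
  rw [h]
  have h0 : (L * D) * (L * D) * L - (coeffP Γ : ℂ) • (L * D * L) + (coeffQ Γ : ℂ) • L = 0 := by
    ext i j
    rw [hD, cubic_entry, hL, Matrix.zero_apply]
    have hp : (coeffP Γ : ℂ) = 2 * (Γ 0 + Γ 1 + Γ 2 + Γ 3) := by simp [coeffP]
    have hq : (coeffQ Γ : ℂ) = 8 / 3 * (Γ 0 * Γ 1 + Γ 0 * Γ 2 + Γ 1 * Γ 2 + Γ 0 * Γ 3 +
      Γ 1 * Γ 3 + Γ 2 * Γ 3) := by simp [coeffQ, pairSum]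
    rw [hp, hq]
    clear h hp hq hL hD L D
    fin_cases i <;> fin_cases j <;> simp [Fin.sum_univ_four] <;> grind
  rw [h0, Matrix.mul_zero]

/-! ### Shape variables of four vortices -/

/-- The pair of the first two vortices. -/
abbrev pair01 : Pairs 3 := ⟨(0, 1), by decide⟩

/-- The pair of the first and the third vortex. -/
abbrev pair02 : Pairs 3 := ⟨(0, 2), by decide⟩

/-- The pair of the second and the third vortex. -/
abbrev pair12 : Pairs 3 := ⟨(1, 2), by decide⟩

lemma univ_pairs : (Finset.univ : Finset (Pairs 3)) = {pair01, pair02, pair12} := by decide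

lemma pairs_cases (p : Pairs 3) : p = pair01 ∨ p = pair02 ∨ p = pair12 := by
  have := Finset.mem_univ p
  rw [univ_pairs] at this
  simpa using this

lemma sum_pairs (f : Pairs 3 → ℝ) : ∑ p, f p = f pair01 + f pair02 + f pair12 := by
  rw [univ_pairs, Finset.sum_insert (by decide), Finset.sum_insert (by decide),
    Finset.sum_singleton, add_assoc]

/-- `|λ_{ij}|²` as a function of the shape variables, for `i < j < N`. -/
def pairNormSq {n : ℕ} (p : Pairs n) (ζ : ShapeVar n) : ℝ :=
  ‖ζ.2 p‖ ^ 2 / (ζ.1 p.1.1 ^ 2 * ζ.1 p.1.2 ^ 2)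

lemma hermitianLift_pair {n : ℕ} (p : Pairs n) (ζ : ShapeVar n) :
    hermitianLift ζ p.1.1.castSucc p.1.2.castSucc = ζ.2 p / (ζ.1 p.1.1 * ζ.1 p.1.2) := by
  rw [hermitianLift_castSucc_castSucc, dif_pos p.2]

lemma hermitianLift_pair_swap {n : ℕ} (p : Pairs n) (ζ : ShapeVar n) :
    hermitianLift ζ p.1.2.castSucc p.1.1.castSucc =
      (starRingEnd ℂ) (ζ.2 p) / (ζ.1 p.1.1 * ζ.1 p.1.2) := by
  rw [hermitianLift_castSucc_castSucc, dif_neg p.2.not_gt, dif_pos p.2, mul_comm (ζ.1 _ : ℂ)]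

lemma hermitianLift_pair_mul {n : ℕ} (p : Pairs n) (ζ : ShapeVar n) :
    hermitianLift ζ p.1.1.castSucc p.1.2.castSucc * hermitianLift ζ p.1.2.castSucc p.1.1.castSucc =
      (pairNormSq p ζ : ℂ) := by
  rw [hermitianLift_pair, hermitianLift_pair_swap, div_mul_div_comm, Complex.mul_conj', pairNormSq]
  push_cast
  congr 1
  ring

/-- The squared moduli enter with the weights `Γ i * Γ j` of the logarithms in the Hamiltonian, so a
multiple of this Casimir supplies the tangent line to all six logarithms at once. -/
lemma casimir_two (Γ : Fin 4 → ℝ) (ζ : ShapeVar 3) :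
    casimir (n := 3) Γ 2 ζ = 4 * (Γ 0 ^ 2 + Γ 1 ^ 2 + Γ 2 ^ 2 + Γ 3 ^ 2) +
      2 * (Γ 0 * Γ 1 * pairNormSq pair01 ζ + Γ 0 * Γ 2 * pairNormSq pair02 ζ +
        Γ 1 * Γ 2 * pairNormSq pair12 ζ + Γ 0 * Γ 3 * ζ.1 0 ^ 2 + Γ 1 * Γ 3 * ζ.1 1 ^ 2 +
        Γ 2 * Γ 3 * ζ.1 2 ^ 2) := by
  have hd : ∀ a : Fin 4, hermitianLift ζ a a = 2 := hermitianLift_diag ζ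
  have h01 : hermitianLift ζ (0 : Fin 4) (1 : Fin 4) * hermitianLift ζ (1 : Fin 4) (0 : Fin 4) =
    (pairNormSq pair01 ζ : ℂ) := hermitianLift_pair_mul pair01 ζ
  have h02 : hermitianLift ζ (0 : Fin 4) (2 : Fin 4) * hermitianLift ζ (2 : Fin 4) (0 : Fin 4) =
    (pairNormSq pair02 ζ : ℂ) := hermitianLift_pair_mul pair02 ζ
  have h12 : hermitianLift ζ (1 : Fin 4) (2 : Fin 4) * hermitianLift ζ (2 : Fin 4) (1 : Fin 4) =
    (pairNormSq pair12 ζ : ℂ) := hermitianLift_pair_mul pair12 ζ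
  have h03 : hermitianLift ζ (0 : Fin 4) (3 : Fin 4) = ζ.1 0 := hermitianLift_castSucc_last ζ 0
  have h13 : hermitianLift ζ (1 : Fin 4) (3 : Fin 4) = ζ.1 1 := hermitianLift_castSucc_last ζ 1
  have h23 : hermitianLift ζ (2 : Fin 4) (3 : Fin 4) = ζ.1 2 := hermitianLift_castSucc_last ζ 2
  have h30 : hermitianLift ζ (3 : Fin 4) (0 : Fin 4) = ζ.1 0 := hermitianLift_last_castSucc ζ 0
  have h31 : hermitianLift ζ (3 : Fin 4) (1 : Fin 4) = ζ.1 1 := hermitianLift_last_castSucc ζ 1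
  have h32 : hermitianLift ζ (3 : Fin 4) (2 : Fin 4) = ζ.1 2 := hermitianLift_last_castSucc ζ 2
  rw [casimir, laxMatrix]
  erw [trace_sq_four]
  simp only [hd, h01, h02, h12, h03, h13, h23, h30, h31, h32]
  norm_cast
  ring

/-! ### The Hamiltonian -/

/-- The part of the phase space on which the Hamiltonian is smooth. -/
def regularSet : Set (ShapeVar 3) :=
  shapeSpace 3 ∩ {ζ | ∀ p, pairNormSq p ζ < 4}

lemma contDiffAt_pairNormSq (p : Pairs 3) {ζ : ShapeVar 3} (hζ : ∀ i, 0 < ζ.1 i) {k : ℕ∞} :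
    ContDiffAt ℝ k (pairNormSq p) ζ := by
  have h1 : ∀ i, ContDiffAt ℝ k (fun w : ShapeVar 3 => w.1 i) ζ := fun i =>
    ((contDiff_apply ℝ ℝ i).comp contDiff_fst).contDiffAt
  have h2 : ContDiffAt ℝ k (fun w : ShapeVar 3 => w.2 p) ζ :=
    ((contDiff_apply ℝ ℂ p).comp contDiff_snd).contDiffAt
  exact (h2.norm_sq ℝ).div (((h1 _).pow 2).mul ((h1 _).pow 2))
    (mul_pos (pow_pos (hζ _) 2) (pow_pos (hζ _) 2)).ne'

lemma contDiffAt_shapeHamiltonian {R : ℝ} (hR : 0 < R) (Γ : Fin 4 → ℝ) {ζ : ShapeVar 3}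
    (hζ : ζ ∈ regularSet) {k : ℕ∞} : ContDiffAt ℝ k (shapeHamiltonian (n := 3) R Γ) ζ := by
  have hpos : ∀ i, 0 < ζ.1 i := fun i => (hζ.1.1 i).1
  have h1 : ∀ i, ContDiffAt ℝ k (fun w : ShapeVar 3 => w.1 i) ζ := fun i =>
    ((contDiff_apply ℝ ℝ i).comp contDiff_fst).contDiffAt
  refine contDiffAt_const.mul ((ContDiffAt.sum fun p _ => ?_).add
    (contDiffAt_const.mul (ContDiffAt.sum fun i _ => ?_)))
  · refine contDiffAt_const.mul (ContDiffAt.log (contDiffAt_const.mul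
      (contDiffAt_const.sub (contDiffAt_pairNormSq p hpos))) ?_)
    exact (mul_pos (pow_pos hR 2) (sub_pos.2 (hζ.2 p))).ne'
  · refine contDiffAt_const.mul (ContDiffAt.log (contDiffAt_const.mul
      (contDiffAt_const.sub ((h1 i).pow 2))) ?_)
    have := hζ.1.1 i
    exact (mul_pos (pow_pos hR 2) (by nlinarith [this.1, this.2] : 0 < 4 - ζ.1 i ^ 2)).ne'

/-- The weighted sum of the functions `log (4 - s) + 3 s / 8` of the squared moduli `s`. -/
def logSum (Γ : Fin 4 → ℝ) (ζ : ShapeVar 3) : ℝ :=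
  Γ 0 * Γ 1 * (Real.log (4 - pairNormSq pair01 ζ) + 3 / 8 * pairNormSq pair01 ζ) +
  Γ 0 * Γ 2 * (Real.log (4 - pairNormSq pair02 ζ) + 3 / 8 * pairNormSq pair02 ζ) +
  Γ 1 * Γ 2 * (Real.log (4 - pairNormSq pair12 ζ) + 3 / 8 * pairNormSq pair12 ζ) +
  Γ 0 * Γ 3 * (Real.log (4 - ζ.1 0 ^ 2) + 3 / 8 * ζ.1 0 ^ 2) +
  Γ 1 * Γ 3 * (Real.log (4 - ζ.1 1 ^ 2) + 3 / 8 * ζ.1 1 ^ 2) +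
  Γ 2 * Γ 3 * (Real.log (4 - ζ.1 2 ^ 2) + 3 / 8 * ζ.1 2 ^ 2)

/-- The coefficient `3 / 16` is half of `3 / 8`, as `casimir_two` counts each pair twice. -/
lemma hamiltonian_add_casimir {R : ℝ} (hR : 0 < R) (Γ : Fin 4 → ℝ) {ζ : ShapeVar 3}
    (hζ : ζ ∈ regularSet) :
    4 * Real.pi * R ^ 2 * shapeHamiltonian (n := 3) R Γ ζ - 3 / 16 * casimir (n := 3) Γ 2 ζ =
      -logSum Γ ζ - pairSum Γ * Real.log (R ^ 2) -
        3 / 4 * (Γ 0 ^ 2 + Γ 1 ^ 2 + Γ 2 ^ 2 + Γ 3 ^ 2) := by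
  have hR2 : R ^ 2 ≠ 0 := (pow_pos hR 2).ne'
  have hp : ∀ p, Real.log (R ^ 2 * (4 - pairNormSq p ζ)) =
      Real.log (R ^ 2) + Real.log (4 - pairNormSq p ζ) := fun p =>
    Real.log_mul hR2 (sub_pos.2 (hζ.2 p)).ne'
  have hi : ∀ i, Real.log (R ^ 2 * (4 - ζ.1 i ^ 2)) =
      Real.log (R ^ 2) + Real.log (4 - ζ.1 i ^ 2) := fun i => by
    have := hζ.1.1 i
    exact Real.log_mul hR2 (by nlinarith [this.1, this.2] : 0 < 4 - ζ.1 i ^ 2).ne'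
  have hH : shapeHamiltonian (n := 3) R Γ ζ = -(1 / (4 * Real.pi * R ^ 2)) *
      ((Γ 0 * Γ 1 * Real.log (R ^ 2 * (4 - pairNormSq pair01 ζ)) +
        Γ 0 * Γ 2 * Real.log (R ^ 2 * (4 - pairNormSq pair02 ζ)) +
        Γ 1 * Γ 2 * Real.log (R ^ 2 * (4 - pairNormSq pair12 ζ))) +
      Γ 3 * (Γ 0 * Real.log (R ^ 2 * (4 - ζ.1 0 ^ 2)) + Γ 1 * Real.log (R ^ 2 * (4 - ζ.1 1 ^ 2)) +
        Γ 2 * Real.log (R ^ 2 * (4 - ζ.1 2 ^ 2)))) := by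
    rw [shapeHamiltonian, sum_pairs, Fin.sum_univ_three]
    rfl
  have hπ : 4 * Real.pi * R ^ 2 ≠ 0 := by positivity
  rw [hH, casimir_two, hp, hp, hp, hi, hi, hi, logSum, pairSum]
  rw [← mul_assoc, mul_neg, mul_one_div_cancel hπ]
  ring

/-- Strict concavity: `log u < u - 1` at `u = (4 - s) * (3 / 8)`. The slope of `log (4 - s)` at the
tetrahedral value `s = 4 / 3` is `-3 / 8`. -/
lemma log_add_lt {s : ℝ} (hs : s < 4) (hne : s ≠ 4 / 3) :
    Real.log (4 - s) + 3 / 8 * s < Real.log (8 / 3) + 1 / 2 := by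
  have h1 : 0 < (4 - s) * (3 / 8) := by linarith
  have h2 := Real.log_lt_sub_one_of_pos h1 (fun h => hne (by linarith))
  rw [show (4 - s) * (3 / 8) = (4 - s) / (8 / 3) by ring,
    Real.log_div (by linarith) (by norm_num)] at h2
  linarith

lemma log_add_le {s : ℝ} (hs : s < 4) :
    Real.log (4 - s) + 3 / 8 * s ≤ Real.log (8 / 3) + 1 / 2 := by
  rcases eq_or_ne s (4 / 3) with rfl | h
  · norm_num
  · exact (log_add_lt hs h).le

lemma eq_of_log_add_eq {s : ℝ} (hs : s < 4)
    (h : Real.log (4 - s) + 3 / 8 * s = Real.log (8 / 3) + 1 / 2) : s = 4 / 3 := by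
  by_contra hne
  exact (log_add_lt hs hne).ne h

lemma logSum_le {Γ : Fin 4 → ℝ} (hΓ : ∀ a, 0 < Γ a) {ζ : ShapeVar 3} (hζ : ζ ∈ regularSet) :
    logSum Γ ζ ≤ pairSum Γ * (Real.log (8 / 3) + 1 / 2) ∧
      (logSum Γ ζ = pairSum Γ * (Real.log (8 / 3) + 1 / 2) →
        (∀ p, pairNormSq p ζ = 4 / 3) ∧ ∀ i, ζ.1 i ^ 2 = 4 / 3) := by
  have hi : ∀ i, ζ.1 i ^ 2 < 4 := fun i => by nlinarith [(hζ.1.1 i).1, (hζ.1.1 i).2]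
  have hm : ∀ a b, 0 < Γ a * Γ b := fun a b => mul_pos (hΓ a) (hΓ b)
  have key : ∀ a b {s : ℝ}, s < 4 → 0 ≤ Γ a * Γ b *
      (Real.log (8 / 3) + 1 / 2 - (Real.log (4 - s) + 3 / 8 * s)) := fun a b s hs =>
    mul_nonneg (hm a b).le (sub_nonneg.2 (log_add_le hs))
  have k1 := key 0 1 (hζ.2 pair01)
  have k2 := key 0 2 (hζ.2 pair02)
  have k3 := key 1 2 (hζ.2 pair12)
  have k4 := key 0 3 (hi 0)
  have k5 := key 1 3 (hi 1)
  have k6 := key 2 3 (hi 2)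
  have hz : ∀ a b {s : ℝ}, s < 4 → Γ a * Γ b *
      (Real.log (8 / 3) + 1 / 2 - (Real.log (4 - s) + 3 / 8 * s)) = 0 → s = 4 / 3 := by
    intro a b s hs h
    exact eq_of_log_add_eq hs (sub_eq_zero.1 ((mul_eq_zero.1 h).resolve_left (hm a b).ne')).symm
  rw [logSum, pairSum]
  refine ⟨by linarith, fun h => ⟨fun p => ?_, fun i => ?_⟩⟩
  · rcases pairs_cases p with rfl | rfl | rfl
    · exact hz 0 1 (hζ.2 pair01) (by linarith)
    · exact hz 0 2 (hζ.2 pair02) (by linarith)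
    · exact hz 1 2 (hζ.2 pair12) (by linarith)
  · have e0 := hz 0 3 (hi 0) (by linarith)
    have e1 := hz 1 3 (hi 1) (by linarith)
    have e2 := hz 2 3 (hi 2) (by linarith)
    fin_cases i
    exacts [e0, e1, e2]

/-! ### The shape of the tetrahedron -/

/-- The shape of a regular tetrahedron; its orientation is the sign of `b`. -/
def tetrahedronShape (b : ℝ) : ShapeVar 3 :=
  (fun _ => √(4 / 3), fun p => ⟨0, if p = pair02 then -b else b⟩)

lemma gram_det (a b c : Fin 3 → ℝ) : (a ⬝ᵥ crossProduct b c) ^ 2 =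
    (a ⬝ᵥ a) * (b ⬝ᵥ b) * (c ⬝ᵥ c) + 2 * (a ⬝ᵥ b) * (b ⬝ᵥ c) * (a ⬝ᵥ c) -
      (a ⬝ᵥ a) * (b ⬝ᵥ c) ^ 2 - (b ⬝ᵥ b) * (a ⬝ᵥ c) ^ 2 - (c ⬝ᵥ c) * (a ⬝ᵥ b) ^ 2 := by
  simp [crossProduct, dotProduct, Fin.sum_univ_three]
  ring

/-- The four vectors sum to zero, which expresses the three signed volumes through one of them up to
sign; the Gram determinant gives its square, `16 / 27 * R ^ 6`. -/
lemma shapeOf_tetrahedron {R : ℝ} (hR : 0 < R) {x : Fin 4 → EuclideanSpace ℝ (Fin 3)}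
    (hx : IsTetrahedron R x) : ∃ b : ℝ, b ^ 2 = 64 / 27 ∧ shapeOf (n := 3) R x = tetrahedronShape b := by
  have hdot : ∀ i j, (x i).ofLp ⬝ᵥ (x j).ofLp = inner ℝ (x i) (x j) := fun i j => by
    rw [EuclideanSpace.inner_eq_star_dotProduct, star_trivial, dotProduct_comm]
  have hdist : ∀ i j, i ≠ j → ‖x i - x j‖ ^ 2 = 8 / 3 * R ^ 2 := fun i j hij => by
    rw [hx.2 i j hij, mul_pow, mul_pow, Real.sq_sqrt (by norm_num)]
    ring
  have hin : ∀ i j, i ≠ j → inner ℝ (x i) (x j) = -R ^ 2 / 3 := fun i j hij => by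
    have := norm_sub_sq_real (x i) (x j)
    rw [hdist i j hij, hx.1, hx.1] at this
    linarith
  have hii : ∀ i, inner ℝ (x i) (x i) = R ^ 2 := fun i => by
    rw [real_inner_self_eq_norm_sq, hx.1]
  have hnsq : ∀ i j, i ≠ j → normSqCoord (n := 3) R x i j = 4 / 3 := fun i j hij => by
    rw [normSqCoord, hdist i j hij]
    field_simp
    norm_num
  -- The squared norm of the sum is `4 R²` plus twelve inner products equal to `-R² / 3`.
  have hsum : x 0 + x 1 + x 2 + x 3 = 0 := by
    rw [← inner_self_eq_zero (𝕜 := ℝ)]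
    simp only [inner_add_left, inner_add_right, hii, hin _ _ (show (0 : Fin 4) ≠ 1 by decide),
      hin _ _ (show (0 : Fin 4) ≠ 2 by decide), hin _ _ (show (0 : Fin 4) ≠ 3 by decide),
      hin _ _ (show (1 : Fin 4) ≠ 2 by decide), hin _ _ (show (1 : Fin 4) ≠ 3 by decide),
      hin _ _ (show (2 : Fin 4) ≠ 3 by decide), hin _ _ (show (1 : Fin 4) ≠ 0 by decide),
      hin _ _ (show (2 : Fin 4) ≠ 0 by decide), hin _ _ (show (3 : Fin 4) ≠ 0 by decide),
      hin _ _ (show (2 : Fin 4) ≠ 1 by decide), hin _ _ (show (3 : Fin 4) ≠ 1 by decide),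
      hin _ _ (show (3 : Fin 4) ≠ 2 by decide)]
    ring
  have hx2 : ∀ k, (x 2).ofLp k = -(x 0).ofLp k - (x 1).ofLp k - (x 3).ofLp k := fun k => by
    have : (x 0 + x 1 + x 2 + x 3).ofLp k = 0 := by rw [hsum]; rfl
    simp only [PiLp.add_apply] at this
    linarith
  have hV02 : signedVolume (n := 3) x 0 2 3 = -signedVolume (n := 3) x 0 1 3 := by
    simp [signedVolume, crossProduct, dotProduct, Fin.sum_univ_three, hx2]
    ring
  have hV12 : signedVolume (n := 3) x 1 2 3 = signedVolume (n := 3) x 0 1 3 := by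
    simp [signedVolume, crossProduct, dotProduct, Fin.sum_univ_three, hx2]
    ring
  refine ⟨2 / R ^ 3 * signedVolume (n := 3) x 0 1 3, ?_, ?_⟩
  · have : signedVolume (n := 3) x 0 1 3 ^ 2 = 16 / 27 * R ^ 6 := by
      rw [signedVolume, gram_det]
      simp only [hdot, hii, hin _ _ (show (0 : Fin 4) ≠ 1 by decide),
        hin _ _ (show (0 : Fin 4) ≠ 3 by decide), hin _ _ (show (1 : Fin 4) ≠ 3 by decide)]
      ring
    rw [mul_pow, this]
    field_simp
    norm_num
  · refine Prod.ext (funext fun i => ?_) (funext fun p => ?_)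
    · exact congrArg Real.sqrt (hnsq _ _ (Fin.castSucc_lt_last i).ne)
    · refine Complex.ext ?_ ?_
      · change normSqCoord R x p.1.1.castSucc p.1.2.castSucc
          + normSqCoord R x p.1.1.castSucc (Fin.last 3)
          + normSqCoord R x p.1.2.castSucc (Fin.last 3) - 4 = 0
        rw [hnsq _ _ (Fin.castSucc_lt_last _).ne, hnsq _ _ (Fin.castSucc_lt_last _).ne,
          hnsq _ _ (fun h => p.2.ne (Fin.castSucc_injective 3 h))]
        norm_num
      · rcases pairs_cases p with rfl | rfl | rfl
        · rfl
        · change 2 / R ^ 3 * signedVolume (n := 3) x 0 2 3 = -(2 / R ^ 3 * signedVolume (n := 3) x 0 1 3)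
          rw [hV02]
          ring
        · change 2 / R ^ 3 * signedVolume (n := 3) x 1 2 3 = 2 / R ^ 3 * signedVolume (n := 3) x 0 1 3
          rw [hV12]

/-! ### The Lyapunov function -/

/-- A combination of the Hamiltonian and the Casimir functions with a strict local minimum, equal
to zero, at the tetrahedra. -/
def lyapunov (R : ℝ) (Γ : Fin 4 → ℝ) (ζ : ShapeVar 3) : ℝ :=
  4 * Real.pi * R ^ 2 * shapeHamiltonian (n := 3) R Γ ζ + casimir (n := 3) Γ 6 ζ +
    (-2 * coeffP Γ) * casimir (n := 3) Γ 5 ζ +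
    (coeffP Γ ^ 2 + 2 * coeffQ Γ) * casimir (n := 3) Γ 4 ζ +
    (-2 * coeffP Γ * coeffQ Γ) * casimir (n := 3) Γ 3 ζ +
    (coeffQ Γ ^ 2 - 3 / 16) * casimir (n := 3) Γ 2 ζ +
    (pairSum Γ * (Real.log (8 / 3) + 1 / 2) + pairSum Γ * Real.log (R ^ 2) +
      3 / 4 * (Γ 0 ^ 2 + Γ 1 ^ 2 + Γ 2 ^ 2 + Γ 3 ^ 2))

/-- The definition, a combination of the energy and Casimirs, shows conservation; this form shows
positivity, as both summands are nonnegative when the circulations are positive. -/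
lemma lyapunov_eq {R : ℝ} (hR : 0 < R) (Γ : Fin 4 → ℝ) {ζ : ShapeVar 3} (hζ : ζ ∈ regularSet) :
    lyapunov R Γ ζ = (pairSum Γ * (Real.log (8 / 3) + 1 / 2) - logSum Γ ζ) +
      (cubic (coeffP Γ) (coeffQ Γ) (laxMatrix (n := 3) Γ ζ) *
        cubic (coeffP Γ) (coeffQ Γ) (laxMatrix (n := 3) Γ ζ)).trace.re := by
  have h1 := hamiltonian_add_casimir hR Γ hζ
  have h2 : (cubic (coeffP Γ) (coeffQ Γ) (laxMatrix (n := 3) Γ ζ) *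
      cubic (coeffP Γ) (coeffQ Γ) (laxMatrix (n := 3) Γ ζ)).trace.re =
      casimir (n := 3) Γ 6 ζ - 2 * coeffP Γ * casimir (n := 3) Γ 5 ζ +
      (coeffP Γ ^ 2 + 2 * coeffQ Γ) * casimir (n := 3) Γ 4 ζ -
      2 * coeffP Γ * coeffQ Γ * casimir (n := 3) Γ 3 ζ +
      coeffQ Γ ^ 2 * casimir (n := 3) Γ 2 ζ := by
    have hc : ∀ (c : ℝ) (z : ℂ), ((c : ℂ) * z).re = c * z.re := Complex.re_ofReal_mul
    rw [trace_cubic_sq]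
    simp only [casimir]
    rw [← hc, ← hc, ← hc, ← hc]
    push_cast
    simp only [Complex.add_re, Complex.sub_re]
  rw [h2, lyapunov]
  linarith

lemma lyapunov_nonneg_and_eq_zero {R : ℝ} (hR : 0 < R) {Γ : Fin 4 → ℝ} (hΓ : ∀ a, 0 < Γ a)
    {ζ : ShapeVar 3} (hζ : ζ ∈ regularSet) :
    0 ≤ lyapunov R Γ ζ ∧ (lyapunov R Γ ζ = 0 →
      (∀ i, ζ.1 i = √(4 / 3)) ∧ ∀ p, (ζ.2 p).re = 0 ∧ (ζ.2 p).im ^ 2 = 64 / 27) := by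
  have h1 := logSum_le hΓ hζ
  have h2 := trace_cubic_sq_nonneg (coeffP Γ) (coeffQ Γ) hΓ (isHermitian_hermitianLift (n := 3) ζ)
  rw [lyapunov_eq hR Γ hζ]
  refine ⟨add_nonneg (sub_nonneg.2 h1.1) h2, fun h0 => ?_⟩
  have h3 : (cubic (coeffP Γ) (coeffQ Γ) (laxMatrix (n := 3) Γ ζ) *
      cubic (coeffP Γ) (coeffQ Γ) (laxMatrix (n := 3) Γ ζ)).trace.re = 0 :=
    le_antisymm (by linarith [h1.1]) h2
  obtain ⟨hs, hr⟩ := h1.2 (by linarith [h1.1])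
  have hpos : ∀ i, 0 < ζ.1 i := fun i => (hζ.1.1 i).1
  have hi : ∀ i, ζ.1 i = √(4 / 3) := fun i => by
    rw [← hr i, Real.sqrt_sq (hpos i).le]
  have hr' : ∀ i, (ζ.1 i : ℂ) * ζ.1 i = 4 / 3 := fun i => by
    rw [← pow_two, ← Complex.ofReal_pow, hr i]
    norm_num
  have hsym : ∀ a b : Fin 4, hermitianLift (n := 3) ζ a b * hermitianLift (n := 3) ζ b a = 4 / 3 →
      hermitianLift (n := 3) ζ b a * hermitianLift (n := 3) ζ a b = 4 / 3 := fun a b h => by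
    rw [mul_comm]; exact h
  have hp : ∀ p : Pairs 3, hermitianLift ζ p.1.1.castSucc p.1.2.castSucc *
      hermitianLift ζ p.1.2.castSucc p.1.1.castSucc = 4 / 3 := fun p => by
    rw [hermitianLift_pair_mul, hs]
    push_cast
    rfl
  have hmod : ∀ a b : Fin 4, a ≠ b →
      hermitianLift (n := 3) ζ a b * hermitianLift (n := 3) ζ b a = 4 / 3 := by
    intro a b
    induction a using Fin.lastCases with
    | last =>
      induction b using Fin.lastCases with
      | last => exact fun h => absurd rfl h
      | cast j => exact fun _ => by rw [hermitianLift_last_castSucc, hermitianLift_castSucc_last, hr']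
    | cast i =>
      induction b using Fin.lastCases with
      | last => exact fun _ => (by rw [hermitianLift_last_castSucc, hermitianLift_castSucc_last, hr'])
      | cast j =>
        intro hij
        rcases lt_trichotomy i j with h | rfl | h
        · exact hp ⟨(i, j), h⟩
        · exact absurd rfl hij
        · exact hsym _ _ (hp ⟨(j, i), h⟩)
  obtain ⟨t01, t02, t12⟩ := triple_re_eq_zero hΓ (isHermitian_hermitianLift (n := 3) ζ)
    (hermitianLift_diag ζ) hmod h3
  -- The product around the triangle of a pair and the last vortex is `μ` itself, so the vanishing
  -- real parts are those of the shape variables.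
  have htri : ∀ p : Pairs 3, hermitianLift ζ p.1.1.castSucc p.1.2.castSucc *
      hermitianLift ζ p.1.2.castSucc (Fin.last 3) * hermitianLift ζ (Fin.last 3) p.1.1.castSucc =
      ζ.2 p := by
    intro p
    have h1 : (ζ.1 p.1.1 : ℂ) ≠ 0 := by exact_mod_cast (hpos _).ne'
    have h2 : (ζ.1 p.1.2 : ℂ) ≠ 0 := by exact_mod_cast (hpos _).ne'
    rw [hermitianLift_pair, hermitianLift_castSucc_last, hermitianLift_last_castSucc]
    field_simp
  refine ⟨hi, fun p => ?_⟩
  have hre : (ζ.2 p).re = 0 := by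
    rcases pairs_cases p with rfl | rfl | rfl
    · rw [← htri]; exact t01
    · rw [← htri]; exact t02
    · rw [← htri]; exact t12
  refine ⟨hre, ?_⟩
  -- With zero real part, the modulus alone gives `(ζ.2 p).im ^ 2 = (4 / 3) ^ 3`.
  have hn := hs p
  rw [pairNormSq, hr, hr, ← Complex.normSq_eq_norm_sq, Complex.normSq_apply, hre] at hn
  field_simp at hn
  linarith

/-- The zero equations fix each `Im μ` only up to sign, and the mirror image of the tetrahedron is
also a zero. The sign condition, which holds near the given tetrahedron, removes this ambiguity. -/
lemma lyapunov_pos {R : ℝ} (hR : 0 < R) {Γ : Fin 4 → ℝ} (hΓ : ∀ a, 0 < Γ a) {b : ℝ}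
    (hb : b ^ 2 = 64 / 27) {ζ : ShapeVar 3} (hζ : ζ ∈ regularSet)
    (hsign : ∀ p, 0 < (ζ.2 p).im * ((tetrahedronShape b).2 p).im) (hne : ζ ≠ tetrahedronShape b) :
    0 < lyapunov R Γ ζ := by
  obtain ⟨h1, h2⟩ := lyapunov_nonneg_and_eq_zero hR hΓ hζ
  refine lt_of_le_of_ne h1 fun h0 => hne ?_
  obtain ⟨h3, h4⟩ := h2 h0.symm
  refine Prod.ext (funext h3) (funext fun p => Complex.ext (h4 p).1 ?_)
  have hsq : (ζ.2 p).im ^ 2 = ((tetrahedronShape b).2 p).im ^ 2 := by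
    rw [(h4 p).2, tetrahedronShape]
    dsimp only
    split_ifs <;> linarith
  rcases sq_eq_sq_iff_eq_or_eq_neg.1 hsq with h | h
  · exact h
  · have := hsign p
    rw [h] at this
    nlinarith [sq_nonneg ((tetrahedronShape b).2 p).im]

lemma pairNormSq_tetrahedronShape {b : ℝ} (hb : b ^ 2 = 64 / 27) (p : Pairs 3) :
    pairNormSq p (tetrahedronShape b) = 4 / 3 := by
  rw [pairNormSq, ← Complex.normSq_eq_norm_sq, Complex.normSq_apply, tetrahedronShape]
  dsimp only
  rw [Real.sq_sqrt (by norm_num)]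
  split_ifs <;> field_simp <;> linarith

lemma tetrahedronShape_mem_regularSet {b : ℝ} (hb : b ^ 2 = 64 / 27) :
    tetrahedronShape b ∈ regularSet := by
  have hb0 : b ≠ 0 := by rintro rfl; norm_num at hb
  refine ⟨⟨fun i => ⟨Real.sqrt_pos.2 (by norm_num), ?_⟩, fun p h => ?_⟩, fun p => ?_⟩
  · change √(4 / 3) < 2
    rw [Real.sqrt_lt' two_pos]
    norm_num
  · have := congrArg Complex.im h
    simp only [tetrahedronShape, Complex.zero_im] at this
    split_ifs at this
    · exact hb0 (neg_eq_zero.1 this)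
    · exact hb0 this
  · change pairNormSq p (tetrahedronShape b) < 4
    rw [pairNormSq_tetrahedronShape hb]
    norm_num

lemma hermitianLift_tetrahedronShape (b : ℝ) :
    hermitianLift (n := 3) (tetrahedronShape b) =
      !![2, (3 / 4 * b : ℝ) * Complex.I, -((3 / 4 * b : ℝ) * Complex.I), (√(4 / 3) : ℝ);
        -((3 / 4 * b : ℝ) * Complex.I), 2, (3 / 4 * b : ℝ) * Complex.I, (√(4 / 3) : ℝ);
        (3 / 4 * b : ℝ) * Complex.I, -((3 / 4 * b : ℝ) * Complex.I), 2, (√(4 / 3) : ℝ);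
        (√(4 / 3) : ℝ), (√(4 / 3) : ℝ), (√(4 / 3) : ℝ), 2] := by
  have hc : ((√(4 / 3) : ℝ) : ℂ) * ((√(4 / 3) : ℝ) : ℂ) = 4 / 3 := by
    rw [← Complex.ofReal_mul, Real.mul_self_sqrt (by norm_num)]
    norm_num
  have hp : ∀ p : Pairs 3, hermitianLift (tetrahedronShape b) p.1.1.castSucc p.1.2.castSucc =
      ((3 / 4 * (if p = pair02 then -b else b) : ℝ) : ℂ) * Complex.I := fun p => by
    rw [hermitianLift_pair]
    simp only [tetrahedronShape, hc]
    have hy : ∀ y : ℝ, (⟨0, y⟩ : ℂ) = y * Complex.I := fun y => by apply Complex.ext <;> simp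
    rw [hy, Complex.ofReal_mul]
    push_cast
    ring
  have hq : ∀ p : Pairs 3, hermitianLift (tetrahedronShape b) p.1.2.castSucc p.1.1.castSucc =
      -(((3 / 4 * (if p = pair02 then -b else b) : ℝ) : ℂ) * Complex.I) := fun p => by
    rw [← (isHermitian_hermitianLift _).apply, hp, star_mul', Complex.star_def, Complex.conj_I,
      Complex.conj_ofReal, mul_neg]
  have hl := hermitianLift_castSucc_last (tetrahedronShape b)
  have hl' := hermitianLift_last_castSucc (tetrahedronShape b)
  have h01 := hp pair01
  have h02 := hp pair02
  have h12 := hp pair12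
  have h10 := hq pair01
  have h20 := hq pair02
  have h21 := hq pair12
  rw [if_neg (by decide)] at h01 h12 h10 h21
  rw [if_pos rfl, mul_neg, Complex.ofReal_neg, neg_mul] at h02 h20
  rw [neg_neg] at h20
  have hd := hermitianLift_diag (tetrahedronShape b)
  ext i j
  fin_cases i <;> fin_cases j
  exacts [hd 0, h01, h02, hl 0, h10, hd 1, h12, hl 1, h20, h21, hd 2, hl 2, hl' 0, hl' 1, hl' 2,
    hd 3]

lemma lyapunov_tetrahedronShape {R : ℝ} (hR : 0 < R) (Γ : Fin 4 → ℝ) {b : ℝ}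
    (hb : b ^ 2 = 64 / 27) : lyapunov R Γ (tetrahedronShape b) = 0 := by
  have hcub : cubic (coeffP Γ) (coeffQ Γ) (laxMatrix (n := 3) Γ (tetrahedronShape b)) = 0 := by
    rw [laxMatrix, hermitianLift_tetrahedronShape]
    refine cubic_tetrahedron Γ ?_ ?_
    · rw [mul_pow, Complex.I_sq, ← Complex.ofReal_pow, mul_pow, hb]
      norm_num
    · rw [← Complex.ofReal_pow, Real.sq_sqrt (by norm_num)]
      norm_num
  have hsq : ∀ i, (tetrahedronShape b).1 i ^ 2 = 4 / 3 := fun i => Real.sq_sqrt (by norm_num)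
  have hlog : logSum Γ (tetrahedronShape b) = pairSum Γ * (Real.log (8 / 3) + 1 / 2) := by
    simp only [logSum, pairNormSq_tetrahedronShape hb, hsq, pairSum]
    norm_num
    ring
  rw [lyapunov_eq hR Γ (tetrahedronShape_mem_regularSet hb), hcub, hlog]
  simp

/-! ### Conservation of the Lyapunov function, time reversal and conclusion -/

section Conserved

variable {E : Type*} [NormedAddCommGroup E] [NormedSpace ℝ E] {f g : E → ℝ} {x u : E}

lemma conserved_add (hf : DifferentiableAt ℝ f x ∧ fderiv ℝ f x u = 0)
    (hg : DifferentiableAt ℝ g x ∧ fderiv ℝ g x u = 0) :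
    DifferentiableAt ℝ (fun y => f y + g y) x ∧ fderiv ℝ (fun y => f y + g y) x u = 0 :=
  ⟨hf.1.add hg.1, by rw [fderiv_fun_add hf.1 hg.1, add_apply, hf.2, hg.2, add_zero]⟩

lemma conserved_const_mul (c : ℝ) (hf : DifferentiableAt ℝ f x ∧ fderiv ℝ f x u = 0) :
    DifferentiableAt ℝ (fun y => c * f y) x ∧ fderiv ℝ (fun y => c * f y) x u = 0 :=
  ⟨hf.1.const_mul c, by rw [fderiv_const_mul hf.1, smul_apply, hf.2, smul_zero]⟩

end Conserved

lemma lyapunov_conserved {R : ℝ} (hR : 0 < R) {Γ : Fin 4 → ℝ} (hΓ : ∀ a, Γ a ≠ 0)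
    {ζ : ShapeVar 3} (hζ : ζ ∈ regularSet) :
    DifferentiableAt ℝ (lyapunov R Γ) ζ ∧
      fderiv ℝ (lyapunov R Γ) ζ (shapeField (n := 3) R Γ ζ) = 0 := by
  have hpos : ∀ i, 0 < ζ.1 i := fun i => (hζ.1.1 i).1
  have hH : DifferentiableAt ℝ (shapeHamiltonian (n := 3) R Γ) ζ :=
    (contDiffAt_shapeHamiltonian hR Γ hζ (k := 1)).differentiableAt one_ne_zero
  rw [shapeField_eq_hamiltonianField R Γ hpos hH]
  have hC : ∀ k, DifferentiableAt ℝ (casimir (n := 3) Γ k) ζ ∧ fderiv ℝ (casimir (n := 3) Γ k) ζ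
      (hamiltonianField (n := 3) Γ (shapeHamiltonian R Γ) ζ) = 0 := fun k =>
    ⟨differentiableAt_casimir Γ k fun i => (hpos i).ne',
      fderiv_casimir_hamiltonianField hΓ k hpos hH⟩
  refine conserved_add (conserved_add (conserved_add (conserved_add (conserved_add (conserved_add
    (conserved_const_mul _ ⟨hH, fderiv_hamiltonianField_self Γ hpos hH⟩) (hC 6))
    (conserved_const_mul _ (hC 5))) (conserved_const_mul _ (hC 4))) (conserved_const_mul _ (hC 3)))
    (conserved_const_mul _ (hC 2))) ⟨differentiableAt_const _, ?_⟩
  simp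

lemma contDiffAt_shapeField {R : ℝ} (hR : 0 < R) (Γ : Fin 4 → ℝ) {ζ : ShapeVar 3}
    (hζ : ∀ᶠ w in 𝓝 ζ, w ∈ regularSet) : ContDiffAt ℝ 1 (shapeField (n := 3) R Γ) ζ := by
  refine (contDiffAt_hamiltonianField Γ (fun i => (hζ.self_of_nhds.1.1 i).1)
    (contDiffAt_shapeHamiltonian hR Γ hζ.self_of_nhds (k := 2))).congr_of_eventuallyEq
    (hζ.mono fun w hw => ?_)
  exact shapeField_eq_hamiltonianField R Γ (fun i => (hw.1.1 i).1)
    ((contDiffAt_shapeHamiltonian hR Γ hw (k := 1)).differentiableAt one_ne_zero)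

lemma eventually_mem_regularSet {ζ : ShapeVar 3} (hζ : ζ ∈ regularSet) :
    ∀ᶠ w in 𝓝 ζ, w ∈ regularSet := by
  have h1 : ∀ i, ContinuousAt (fun w : ShapeVar 3 => w.1 i) ζ := fun i =>
    ((continuous_apply i).comp continuous_fst).continuousAt
  have h2 : ∀ p, ContinuousAt (fun w : ShapeVar 3 => w.2 p) ζ := fun p =>
    ((continuous_apply p).comp continuous_snd).continuousAt
  refine ((eventually_all.2 fun i => (h1 i).eventually (isOpen_Ioo.mem_nhds (hζ.1.1 i))).and
    (eventually_all.2 fun p => (h2 p).eventually_ne (hζ.1.2 p))).and (eventually_all.2 fun p => ?_)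
  exact (contDiffAt_pairNormSq p (fun i => (hζ.1.1 i).1) (k := 0)).continuousAt.eventually_lt
    continuousAt_const (hζ.2 p)

/-- Changing the sign of all circulations reverses time. -/
lemma shapeField_neg {n : ℕ} (R : ℝ) (Γ : Fin (n + 1) → ℝ) (ζ : ShapeVar n) :
    shapeField R (-Γ) ζ = -shapeField R Γ ζ := by
  -- The Hamiltonian is quadratic in the circulations and does not change; the bracket contains
  -- `D_Γ⁻¹` once in each term and changes sign.
  have hH : shapeHamiltonian R (-Γ) = shapeHamiltonian R Γ := by
    ext w
    simp only [shapeHamiltonian, Pi.neg_apply, neg_mul, mul_neg,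
      Finset.sum_neg_distrib, neg_neg]
  have hD : Matrix.diagonal (fun i => (((-Γ) i : ℝ) : ℂ)⁻¹) =
      -Matrix.diagonal (fun i => ((Γ i : ℝ) : ℂ)⁻¹) := by
    rw [Matrix.diagonal_neg]
    congr 1
    ext i
    simp [inv_neg]
  have hB : ∀ F G : ShapeVar n → ℝ, shapeBracket (-Γ) F G ζ = -shapeBracket Γ F G ζ := by
    intro F G
    simp only [shapeBracket, liePoisson, lieBracket, hD, pairing, Matrix.mul_neg, Matrix.neg_mul,
      sub_neg_eq_add, neg_add_eq_sub, neg_neg]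
    rw [← neg_sub, Matrix.mul_neg, Matrix.trace_neg, mul_neg, Complex.neg_re, neg_neg]
  refine Prod.ext (funext fun i => ?_) (funext fun p => Complex.ext ?_ ?_)
  all_goals
    simp only [shapeField, hH, hB]
    rfl

/-- All conditions are local, so a common closed ball exists and no explicit radius has to be found.
-/
theorem isStableEquilibrium_of_conserved_eventually {E : Type*} [NormedAddCommGroup E]
    [NormedSpace ℝ E] [FiniteDimensional ℝ E] {v : E → E} {S : Set E} {V : E → ℝ} {z : E}
    (hS : ∀ᶠ x in 𝓝 z, x ∈ S) (hv : ∀ᶠ x in 𝓝 z, ContDiffAt ℝ 1 v x)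
    (hV : ∀ᶠ x in 𝓝 z, DifferentiableAt ℝ V x ∧ fderiv ℝ V x (v x) = 0) (hVz : V z = 0)
    (hVpos : ∀ᶠ x in 𝓝 z, x ≠ z → 0 < V x) : IsStableEquilibrium v S z := by
  obtain ⟨r, hr, h⟩ := Metric.nhds_basis_closedBall.eventually_iff.1
    (hS.and (hv.and (hV.and hVpos)))
  exact isStableEquilibrium_of_conserved hr (fun x hx => (h hx).1) (fun x hx => (h hx).2.1)
    (fun x hx => (h hx).2.2.1.1) (fun x hx => (h hx).2.2.1.2) hVz (fun x hx => (h hx).2.2.2)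

end VortexShape

end

theorem mainTheorem3 (R : ℝ) (hR : 0 < R) (Γ : Fin 4 → ℝ)
    (hΓ : (∀ i, 0 < Γ i) ∨ (∀ i, Γ i < 0))
    (x : Fin 4 → EuclideanSpace ℝ (Fin 3)) (hx : VortexShape.IsTetrahedron R x) :
    VortexShape.IsStableEquilibrium (VortexShape.shapeField (n := 3) R Γ)
      (VortexShape.shapeSpace 3) (VortexShape.shapeOf R x) := by
  open VortexShape Filter Topology in
  obtain ⟨b, hb, hxb⟩ := shapeOf_tetrahedron hR hx
  rw [hxb]
  have hreg := eventually_mem_regularSet (tetrahedronShape_mem_regularSet hb)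
  have hb0 : b ≠ 0 := by rintro rfl; norm_num at hb
  have hsign : ∀ᶠ w in 𝓝 (tetrahedronShape b), ∀ p,
      0 < (w.2 p).im * ((tetrahedronShape b).2 p).im := by
    refine eventually_all.2 fun p => ?_
    have hc : Continuous fun w : ShapeVar 3 => (w.2 p).im * ((tetrahedronShape b).2 p).im :=
      (Complex.continuous_im.comp ((continuous_apply p).comp continuous_snd)).mul continuous_const
    refine hc.continuousAt.eventually_const_lt (mul_self_pos.2 ?_)
    simp only [tetrahedronShape]
    split_ifs
    exacts [neg_ne_zero.2 hb0, hb0]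
  have hv := hreg.eventually_nhds.mono fun w hw => contDiffAt_shapeField hR Γ hw
  have hS := hreg.mono fun w hw => hw.1
  rcases hΓ with hΓ | hΓ
  · exact isStableEquilibrium_of_conserved_eventually hS hv
      (hreg.mono fun w hw => lyapunov_conserved hR (fun a => (hΓ a).ne') hw)
      (lyapunov_tetrahedronShape hR Γ hb)
      ((hreg.and hsign).mono fun w hw hne => lyapunov_pos hR hΓ hb hw.1 hw.2 hne)
  -- The Lyapunov function of `-Γ` is conserved by the field of `-Γ`, hence by its negative, the
  -- field of `Γ`.
  · have hΓ' : ∀ a, 0 < (-Γ) a := fun a => neg_pos.2 (hΓ a)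
    refine isStableEquilibrium_of_conserved_eventually (V := lyapunov R (-Γ)) hS hv
      (hreg.mono fun w hw => ?_) (lyapunov_tetrahedronShape hR (-Γ) hb)
      ((hreg.and hsign).mono fun w hw hne => lyapunov_pos hR hΓ' hb hw.1 hw.2 hne)
    obtain ⟨h1, h2⟩ := lyapunov_conserved hR (fun a => (hΓ' a).ne') hw
    refine ⟨h1, ?_⟩
    have h3 := shapeField_neg (n := 3) R Γ w
    rw [h3, map_neg, neg_eq_zero] at h2
    exact h2
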